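/- Let $M$ be a connected smooth manifold of dimension $n$ with a smooth (pseudo-)Riemannian metric $g_{ij}$ of any signature, let $V$ be a smooth function on $M$, and let $\Delta u=|g|^{-1/2}\partial_i\bigl(|g|^{1/2}g^{ij}\partial_j u\bigr)$ be the Laplace operator of $g$. Consider the Klein–Gordon equation $$\Delta u-V(x^k)\,u=0 ,$$ i.e. in local coordinates the function $H(x^k,u,u_i,u_{ij})=g^{ij}u_{ij}+|g|^{-1/2}\bigl(|g|^{1/2}g^{ij}\bigr)_{,i}u_j-Vu$ on second order jets. A smooth vector field $X=\xi^i(x^k,u)\partial_i+\eta(x^k,u)\partial_u$ on $M\times\mathbb R$ is called a Lie point symmetry of this equation if in every chart of $M$ there is a function $\lambda$ of $(x^k,u,u_i,u_{ij})$ with $X^{[2]}H=\lambda H$ at all second order jets, where $X^{[2]}=X+\eta_{[i]}\partial_{u_i}+\eta_{[ij]}\partial_{u_{ij}}$ is the second prolongation, $\eta_{[i]}=D_i\eta-u_kD_i\xi^k$, $\eta_{[ij]}=D_j\eta_{[i]}-u_{ik}D_j\xi^k$, and $D_i$ is the total derivative. A smooth vector field $\xi^i(x^k)\partial_i$ on $M$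 is a conformal Killing vector (CKV) with conformal factor $\psi$, a smooth function on $M$, if $L_\xi g_{ij}=2\psi g_{ij}$. a) If $n>2$, then $X$ is a Lie point symmetry of the Klein–Gordon equation if and only if $$X=\xi^i(x^k)\partial_i+\Bigl(\tfrac{2-n}{2}\psi(x^k)u+a_0u+b(x^k)\Bigr)\partial_u ,$$ where $\xi^i$ is a CKV with conformal factor $\psi$, $a_0$ is a constant, $b$ is a smooth solution of the Klein–Gordon equation, and $$\xi^kV_{,k}+2\psi V-\tfrac{2-n}{2}\Delta\psi=0 .$$ b) If $n=2$, then $X$ is a Lie point symmetry of the Klein–Gordon equation if and only if $$X=\xi^i(x^k)\partial_i+\bigl(a_0u+b(x^k)\bigr)\partial_u ,$$ where $\xi^i$ is a CKV with conformal factor $\psi$, $a_0$ is a constant, $b$ is a smooth solution of the Klein–Gordon equation, and $$\xi^kV_{,k}+2\psi V=0 .$$ -/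

import Mathlib

open scoped Manifold ContDiff

noncomputable section

namespace LieSymmetry

/-! ## Coordinate expressions on (open subsets of) `ℝⁿ` -/

/-- The coordinate space `ℝⁿ`. -/
abbrev Coord (n : ℕ) := EuclideanSpace ℝ (Fin n)

/-- The `i`-th coordinate vector `e_i`. -/
def coordVec {n : ℕ} (i : Fin n) : Coord n := EuclideanSpace.single i (1 : ℝ)

/-- The partial derivative `f_{,i} = ∂f/∂xⁱ`. -/
def pd {n : ℕ} (i : Fin n) (f : Coord n → ℝ) (x : Coord n) : ℝ :=
  fderiv ℝ f x (coordVec i)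

/-- `√|g|`, where `g = det (g_ij)`. -/
def sqrtDet {n : ℕ} (G : Coord n → Matrix (Fin n) (Fin n) ℝ) (x : Coord n) : ℝ :=
  Real.sqrt |(G x).det|

/-- The Laplace operator `Δf = |g|^{-1/2} ∂_i (|g|^{1/2} g^{ij} ∂_j f)`. -/
def laplacian {n : ℕ} (G : Coord n → Matrix (Fin n) (Fin n) ℝ) (f : Coord n → ℝ)
    (x : Coord n) : ℝ :=
  (sqrtDet G x)⁻¹ * ∑ i, pd i (fun y => sqrtDet G y * ∑ j, (G y)⁻¹ i j * pd j f y) x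

/-- The Lie derivative `(L_ξ g)_ij = ξᵏ g_{ij,k} + g_{kj} ξᵏ_{,i} + g_{ik} ξᵏ_{,j}`. -/
def lieMetric {n : ℕ} (G : Coord n → Matrix (Fin n) (Fin n) ℝ) (ξ : Coord n → Coord n)
    (i j : Fin n) (x : Coord n) : ℝ :=
  ∑ k, (ξ x k * pd k (fun y => G y i j) x + G x k j * pd i (fun y => ξ y k) x
    + G x i k * pd j (fun y => ξ y k) x)

/-- Points `(x, u)`. -/
abbrev Jet0 (n : ℕ) := Coord n × ℝ

/-- First order jets `(x, u, u_i)`. -/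
abbrev Jet1 (n : ℕ) := Coord n × ℝ × (Fin n → ℝ)

/-- Second order jets `(x, u, u_i, u_ij)`; the actual jets are those with `u_ij = u_ji`. -/
abbrev Jet2 (n : ℕ) := Coord n × ℝ × (Fin n → ℝ) × (Fin n → Fin n → ℝ)

/-- The total derivative `D_i F = F_{,i} + u_i F_u` of a function of `(x, u)`. -/
def totalDeriv0 {n : ℕ} (i : Fin n) (F : Jet0 n → ℝ) (J : Jet1 n) : ℝ :=
  fderiv ℝ F (J.1, J.2.1) (coordVec i, J.2.2 i)

/-- The total derivative `D_i F = F_{,i} + u_i F_u + u_{ik} F_{u_k}` of a function of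
`(x, u, u_k)`. -/
def totalDeriv1 {n : ℕ} (i : Fin n) (F : Jet1 n → ℝ) (J : Jet2 n) : ℝ :=
  fderiv ℝ F (J.1, J.2.1, J.2.2.1) (coordVec i, J.2.2.1 i, J.2.2.2 i)

/-- `η_[i] = D_i η - u_k D_i ξᵏ`. -/
def eta1 {n : ℕ} (ξ : Jet0 n → Coord n) (η : Jet0 n → ℝ) (i : Fin n) (J : Jet1 n) : ℝ :=
  totalDeriv0 i η J - ∑ k, J.2.2 k * totalDeriv0 i (fun z => ξ z k) J

/-- `η_[ij] = D_j η_[i] - u_{ik} D_j ξᵏ`. -/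
def eta2 {n : ℕ} (ξ : Jet0 n → Coord n) (η : Jet0 n → ℝ) (i j : Fin n) (J : Jet2 n) : ℝ :=
  totalDeriv1 j (eta1 ξ η i) J
    - ∑ k, J.2.2.2 i k * totalDeriv0 j (fun z => ξ z k) (J.1, J.2.1, J.2.2.1)

/-- The components of the second prolongation
`X^[2] = ξⁱ ∂_i + η ∂_u + η_[i] ∂_{u_i} + η_[ij] ∂_{u_ij}` at a jet. -/
def prolong2 {n : ℕ} (ξ : Jet0 n → Coord n) (η : Jet0 n → ℝ) (J : Jet2 n) : Jet2 n :=
  (ξ (J.1, J.2.1), η (J.1, J.2.1), fun i => eta1 ξ η i (J.1, J.2.1, J.2.2.1),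
    fun i j => eta2 ξ η i j J)

/-- `X^[2] H`, the derivative of a function `H` on second order jets along `X^[2]`. -/
def prolongApply {n : ℕ} (ξ : Jet0 n → Coord n) (η : Jet0 n → ℝ) (H : Jet2 n → ℝ)
    (J : Jet2 n) : ℝ :=
  fderiv ℝ H J (prolong2 ξ η J)

/-- The Klein–Gordon equation as a function on second order jets:
`H(x, u, u_i, u_ij) = g^{ij} u_ij + |g|^{-1/2} (|g|^{1/2} g^{ij})_{,i} u_j - V u`. -/
def kgFun {n : ℕ} (G : Coord n → Matrix (Fin n) (Fin n) ℝ) (V : Coord n → ℝ)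
    (J : Jet2 n) : ℝ :=
  (∑ i, ∑ j, (G J.1)⁻¹ i j * J.2.2.2 i j)
    + (∑ j, (sqrtDet G J.1)⁻¹ * (∑ i, pd i (fun y => sqrtDet G y * (G y)⁻¹ i j) J.1)
        * J.2.2.1 j)
    - V J.1 * J.2.1

/-- On the 2-jet of a function `f`, the function `kgFun` is `Δf - V f`. -/
theorem kgFun_jet {n : ℕ} (G : Coord n → Matrix (Fin n) (Fin n) ℝ) (V f : Coord n → ℝ)
    (x : Coord n) (hx : (G x).det ≠ 0)
    (hG : ∀ i j, DifferentiableAt ℝ (fun y => sqrtDet G y * (G y)⁻¹ i j) x)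
    (hf : ∀ j, DifferentiableAt ℝ (pd j f) x) :
    kgFun G V (x, f x, fun i => pd i f x, fun i j => pd i (pd j f) x)
      = laplacian G f x - V x * f x := by
  have hs : sqrtDet G x ≠ 0 := (Real.sqrt_pos.2 (abs_pos.2 hx)).ne'
  have key : ∀ i, pd i (fun y => sqrtDet G y * ∑ j, (G y)⁻¹ i j * pd j f y) x
      = ∑ j, (sqrtDet G x * (G x)⁻¹ i j * pd i (pd j f) x
        + pd i (fun y => sqrtDet G y * (G y)⁻¹ i j) x * pd j f x) := by
    intro i
    have e : (fun y => sqrtDet G y * ∑ j, (G y)⁻¹ i j * pd j f y)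
        = fun y => ∑ j, (sqrtDet G y * (G y)⁻¹ i j) * pd j f y := by
      funext y
      rw [Finset.mul_sum]
      exact Finset.sum_congr rfl fun j _ => by ring
    have h := HasFDerivAt.fun_sum (u := Finset.univ)
      fun j _ => ((hG i j).hasFDerivAt).mul ((hf j).hasFDerivAt)
    rw [e]
    unfold pd
    erw [h.fderiv]
    rw [_root_.sum_apply]
    refine Finset.sum_congr rfl fun j _ => ?_
    simp only [_root_.add_apply, _root_.smul_apply, smul_eq_mul]
    unfold pd
    ring
  unfold kgFun laplacian
  simp only [key, Finset.sum_add_distrib, mul_add]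
  congr 2
  · rw [Finset.mul_sum]
    refine Finset.sum_congr rfl fun i _ => ?_
    rw [Finset.mul_sum]
    refine Finset.sum_congr rfl fun j _ => ?_
    field_simp
  · rw [Finset.sum_comm, Finset.mul_sum]
    refine Finset.sum_congr rfl fun j _ => ?_
    rw [← Finset.sum_mul, mul_assoc]

/-! ## Manifolds and charts -/

section Manifold

variable {n : ℕ} {M : Type*} [TopologicalSpace M] [ChartedSpace (Coord n) M]

variable (n M) in
/-- A smooth (pseudo-)Riemannian metric, of arbitrary signature. -/
structure PseudoMetric [IsManifold (𝓡 n) ∞ M] where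
  /-- The bilinear form on each tangent space. -/
  val : ∀ p : M, TangentSpace (𝓡 n) p →L[ℝ] TangentSpace (𝓡 n) p →L[ℝ] ℝ
  symm : ∀ (p : M) (v w : TangentSpace (𝓡 n) p), val p v w = val p w v
  nondegenerate : ∀ (p : M) (v : TangentSpace (𝓡 n) p), (∀ w, val p v w = 0) → v = 0
  contMDiff : ContMDiff (𝓡 n) ((𝓡 n).prod 𝓘(ℝ, Coord n →L[ℝ] Coord n →L[ℝ] ℝ)) ∞
    (fun p => Bundle.TotalSpace.mk' (Coord n →L[ℝ] Coord n →L[ℝ] ℝ) p (val p))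

/-- The component matrix `g_ij` of the metric in a chart `φ`. -/
def PseudoMetric.inChart [IsManifold (𝓡 n) ∞ M] (g : PseudoMetric n M)
    (φ : OpenPartialHomeomorph M (Coord n)) (x : Coord n) : Matrix (Fin n) (Fin n) ℝ :=
  Matrix.of fun i j =>
    g.val (φ.symm x) (mfderiv (𝓡 n) (𝓡 n) φ.symm x (coordVec i : Coord n))
      (mfderiv (𝓡 n) (𝓡 n) φ.symm x (coordVec j : Coord n))

/-- The components in the chart `φ`, at the point with coordinates `x`, of a tangent vector at
that point. -/
def vecInChart (φ : OpenPartialHomeomorph M (Coord n)) (x : Coord n)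
    (v : TangentSpace (𝓡 n) (φ.symm x)) : Coord n :=
  mfderiv (𝓡 n) (𝓡 n) φ (φ.symm x) v

/-- The components `ξⁱ(x)` in the chart `φ` of a vector field on `M`. -/
def fieldInChart (φ : OpenPartialHomeomorph M (Coord n))
    (ζ : ∀ p : M, TangentSpace (𝓡 n) p) (x : Coord n) : Coord n :=
  vecInChart φ x (ζ (φ.symm x))

/-- The components `ξⁱ(x, u)` in the chart `φ` of a family, depending on `u`, of vector fields
on `M`. -/
def familyInChart (φ : OpenPartialHomeomorph M (Coord n))
    (ξ : ∀ p : M, ℝ → TangentSpace (𝓡 n) p) (z : Jet0 n) : Coord n :=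
  vecInChart φ z.1 (ξ (φ.symm z.1) z.2)

/-- `X = ξⁱ(x, u) ∂_i + η(x, u) ∂_u` is a smooth vector field on `M × ℝ`. -/
def IsSmoothGenerator [IsManifold (𝓡 n) ∞ M] (ξ : ∀ p : M, ℝ → TangentSpace (𝓡 n) p)
    (η : M → ℝ → ℝ) : Prop :=
  ContMDiff ((𝓡 n).prod 𝓘(ℝ, ℝ)) (𝓡 n).tangent ∞
      (fun z : M × ℝ => (⟨z.1, ξ z.1 z.2⟩ : TangentBundle (𝓡 n) M)) ∧
    ContMDiff ((𝓡 n).prod 𝓘(ℝ, ℝ)) 𝓘(ℝ, ℝ) ∞ (fun z : M × ℝ => η z.1 z.2)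

/-- `X = ξⁱ(x, u) ∂_i + η(x, u) ∂_u` is (the generator of) a Lie point symmetry of the
Klein–Gordon equation `Δu - V u = 0`: it is smooth and, in every chart, there is a function `λ`
on second order jets with `X^[2] H = λ H`. -/
def IsLiePointSymmetry [IsManifold (𝓡 n) ∞ M] (g : PseudoMetric n M) (V : M → ℝ)
    (ξ : ∀ p : M, ℝ → TangentSpace (𝓡 n) p) (η : M → ℝ → ℝ) : Prop :=
  IsSmoothGenerator ξ η ∧
    ∀ φ ∈ IsManifold.maximalAtlas (𝓡 n) ∞ M, ∃ lam : Jet2 n → ℝ,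
      ∀ J : Jet2 n, J.1 ∈ φ.target → (∀ i j, J.2.2.2 i j = J.2.2.2 j i) →
        prolongApply (familyInChart φ ξ) (fun z => η (φ.symm z.1) z.2)
            (kgFun (g.inChart φ) (fun x => V (φ.symm x))) J
          = lam J * kgFun (g.inChart φ) (fun x => V (φ.symm x)) J

/-- `ζ` is a (smooth) conformal Killing vector of `g` with conformal factor `ψ`:
`L_ζ g = 2 ψ g`. -/
def IsCKV [IsManifold (𝓡 n) ∞ M] (g : PseudoMetric n M)
    (ζ : ∀ p : M, TangentSpace (𝓡 n) p) (ψ : M → ℝ) : Prop :=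
  ContMDiff (𝓡 n) (𝓡 n).tangent ∞ (fun p => (⟨p, ζ p⟩ : TangentBundle (𝓡 n) M)) ∧
    ContMDiff (𝓡 n) 𝓘(ℝ, ℝ) ∞ ψ ∧
    ∀ φ ∈ IsManifold.maximalAtlas (𝓡 n) ∞ M, ∀ x ∈ φ.target, ∀ i j,
      lieMetric (g.inChart φ) (fieldInChart φ ζ) i j x
        = 2 * ψ (φ.symm x) * g.inChart φ x i j

/-- `b` is a (smooth) solution of the Klein–Gordon equation `Δb - V b = 0`. -/
def IsKGSolution [IsManifold (𝓡 n) ∞ M] (g : PseudoMetric n M) (V b : M → ℝ) : Prop :=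
  ContMDiff (𝓡 n) 𝓘(ℝ, ℝ) ∞ b ∧
    ∀ φ ∈ IsManifold.maximalAtlas (𝓡 n) ∞ M, ∀ x ∈ φ.target,
      laplacian (g.inChart φ) (fun y => b (φ.symm y)) x - V (φ.symm x) * b (φ.symm x) = 0

/-- The condition `ζᵏ V_{,k} + 2 ψ V - c Δψ = 0`. -/
def PotentialCondition [IsManifold (𝓡 n) ∞ M] (g : PseudoMetric n M) (V : M → ℝ)
    (ζ : ∀ p : M, TangentSpace (𝓡 n) p) (ψ : M → ℝ) (c : ℝ) : Prop :=
  ∀ φ ∈ IsManifold.maximalAtlas (𝓡 n) ∞ M, ∀ x ∈ φ.target,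
    (∑ k, fieldInChart φ ζ x k * pd k (fun y => V (φ.symm y)) x)
        + 2 * ψ (φ.symm x) * V (φ.symm x)
        - c * laplacian (g.inChart φ) (fun y => ψ (φ.symm y)) x = 0

end Manifold

end LieSymmetry

end

open LieSymmetry

noncomputable section

namespace LieSymmetry

/-! ## Calculus with partial derivatives -/

section Directional

variable {E : Type*} [NormedAddCommGroup E] [NormedSpace ℝ E] {x : E}

/-! Over a fixed point `(x, u, u_i)` both `H` and `X^[2] H` are affine in the symmetric matrix
`u_ij`, and `H = 0` is the hyperplane `g^{ij} u_ij = V u - B^j u_j`, with `B` the `drift`. An affine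
function vanishing on a hyperplane is a multiple of its equation (`symmetrized_eq_of_vanish`), so
the symmetrized coefficient of `u_ij` in `X^[2] H` is `2 μ g^{ij}`, and the part without `u_ij` is
fixed by the same `μ` (`VanishesOnShell.symbol_eq`).

Comparing the symbol at two values of `u_i` makes the rank one matrix `ξ_u ⊗ ξ_u` proportional to
the inverse metric; for `n ≥ 2` this forces `ξ_u = 0` (`VanishesOnShell.pdu_eq_zero`). The symbol
equation then says that `ξ` is conformal, with `2 ψ = η_u - μ` (`VanishesOnShell.conformal`).

What remains is a quadratic polynomial in `u_i` that vanishes identically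
(`VanishesOnShell.lower_order`). Its quadratic coefficient is `η_uu g^{ij}`, so `η = a u + b`. Its
linear coefficient gives `2 a_{,i} = (2 - n) ψ_{,i}`, once the derivative of `B` along a conformal
field is known (`IsMetricOn.fderiv_drift_conformal`). Its constant coefficient is affine in `u` and
splits into `Δb = V b` and `ξ^k V_{,k} + 2 ψ V = Δa`. Reading the same formulas backwards gives the
converse, with `λ = a - 2 ψ`.

To pass to the manifold, `ψ` is written as a trace, which is chart independent because the Lie
derivative of the metric is a tensor (`lieMetric_transition`, `confFactor_transition`).
Connectedness integrates the gradient equation to `a = (2 - n)/2 ψ + a₀`. The case `n = 2` is the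
specialization in which the coefficient of `ψ` is zero. -/

theorem fderiv_mul_apply {f f' : E → ℝ} (hf : DifferentiableAt ℝ f x)
    (hf' : DifferentiableAt ℝ f' x) (v : E) :
    fderiv ℝ (fun y => f y * f' y) x v = f x * fderiv ℝ f' x v + fderiv ℝ f x v * f' x := by
  rw [fderiv_fun_mul hf hf']
  simp [mul_comm]

theorem fderiv_add_apply {f f' : E → ℝ} (hf : DifferentiableAt ℝ f x)
    (hf' : DifferentiableAt ℝ f' x) (v : E) :
    fderiv ℝ (fun y => f y + f' y) x v = fderiv ℝ f x v + fderiv ℝ f' x v := by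
  rw [fderiv_fun_add hf hf']
  simp

theorem fderiv_sum_apply {ι : Type*} {s : Finset ι} {f : ι → E → ℝ}
    (hf : ∀ i ∈ s, DifferentiableAt ℝ (f i) x) (v : E) :
    fderiv ℝ (fun y => ∑ i ∈ s, f i y) x v = ∑ i ∈ s, fderiv ℝ (f i) x v := by
  rw [fderiv_fun_sum hf]
  simp

theorem fderiv_sub_apply {f f' : E → ℝ} (hf : DifferentiableAt ℝ f x)
    (hf' : DifferentiableAt ℝ f' x) (v : E) :
    fderiv ℝ (fun y => f y - f' y) x v = fderiv ℝ f x v - fderiv ℝ f' x v := by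
  rw [fderiv_fun_sub hf hf']
  simp

end Directional

section Calculus

variable {n : ℕ} {U : Set (Coord n)} {x : Coord n}

theorem eq_sum_coordVec (v : Coord n) : v = ∑ k, v k • coordVec k := by
  ext j
  simp [coordVec, Pi.single_apply]

theorem fderiv_eq_sum_pd (f : Coord n → ℝ) (x v : Coord n) :
    fderiv ℝ f x v = ∑ k, v k * pd k f x := by
  conv_lhs => rw [eq_sum_coordVec v]
  simp [pd]

theorem differentiableAt_of_contDiffOn {f : Coord n → ℝ} (hU : IsOpen U)
    (hf : ContDiffOn ℝ ∞ f U) (hx : x ∈ U) : DifferentiableAt ℝ f x :=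
  (hf.contDiffAt (hU.mem_nhds hx)).differentiableAt (by simp)

theorem contDiffOn_fderiv_apply {f : Coord n → ℝ} {ξ : Coord n → Coord n} (hU : IsOpen U)
    (hf : ContDiffOn ℝ ∞ f U) (hξ : ContDiffOn ℝ ∞ ξ U) :
    ContDiffOn ℝ ∞ (fun y => fderiv ℝ f y (ξ y)) U :=
  (hf.fderiv_of_isOpen hU (by simp)).clm_apply hξ

theorem contDiffOn_pd {f : Coord n → ℝ} (hU : IsOpen U) (hf : ContDiffOn ℝ ∞ f U) (i : Fin n) :
    ContDiffOn ℝ ∞ (pd i f) U :=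
  contDiffOn_fderiv_apply hU hf contDiffOn_const

theorem pd_congr {f f' : Coord n → ℝ} (hU : IsOpen U) (h : ∀ y ∈ U, f y = f' y) (hx : x ∈ U)
    (i : Fin n) : pd i f x = pd i f' x := by
  unfold pd
  rw [Filter.EventuallyEq.fderiv_eq (Filter.eventuallyEq_of_mem (hU.mem_nhds hx) h)]

theorem fderiv_congr_on {f f' : Coord n → ℝ} (hU : IsOpen U) (h : ∀ y ∈ U, f y = f' y)
    (hx : x ∈ U) : fderiv ℝ f x = fderiv ℝ f' x :=
  Filter.EventuallyEq.fderiv_eq (Filter.eventuallyEq_of_mem (hU.mem_nhds hx) h)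

theorem pd_mul {f f' : Coord n → ℝ} (hf : DifferentiableAt ℝ f x)
    (hf' : DifferentiableAt ℝ f' x) (i : Fin n) :
    pd i (fun y => f y * f' y) x = f x * pd i f' x + pd i f x * f' x :=
  fderiv_mul_apply hf hf' _

theorem pd_add {f f' : Coord n → ℝ} (hf : DifferentiableAt ℝ f x)
    (hf' : DifferentiableAt ℝ f' x) (i : Fin n) :
    pd i (fun y => f y + f' y) x = pd i f x + pd i f' x :=
  fderiv_add_apply hf hf' _

theorem pd_sub {f f' : Coord n → ℝ} (hf : DifferentiableAt ℝ f x)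
    (hf' : DifferentiableAt ℝ f' x) (i : Fin n) :
    pd i (fun y => f y - f' y) x = pd i f x - pd i f' x :=
  fderiv_sub_apply hf hf' _

theorem pd_sum {ι : Type*} {s : Finset ι} {f : ι → Coord n → ℝ}
    (hf : ∀ k ∈ s, DifferentiableAt ℝ (f k) x) (i : Fin n) :
    pd i (fun y => ∑ k ∈ s, f k y) x = ∑ k ∈ s, pd i (f k) x :=
  fderiv_sum_apply hf _

theorem pd_const_mul {f : Coord n → ℝ} (hf : DifferentiableAt ℝ f x) (c : ℝ) (i : Fin n) :
    pd i (fun y => c * f y) x = c * pd i f x := by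
  rw [pd, fderiv_const_mul hf]
  rfl

theorem fderiv_fderiv_comm {f : Coord n → ℝ} (hf : ContDiffAt ℝ ∞ f x) (v w : Coord n) :
    fderiv ℝ (fun y => fderiv ℝ f y v) x w = fderiv ℝ (fun y => fderiv ℝ f y w) x v := by
  have h : DifferentiableAt ℝ (fderiv ℝ f) x :=
    (hf.fderiv_right (m := ∞) le_rfl).differentiableAt (by simp)
  have e : ∀ v w : Coord n, fderiv ℝ (fun y => fderiv ℝ f y v) x w
      = fderiv ℝ (fderiv ℝ f) x w v := by
    intro v w
    rw [fderiv_clm_apply h (differentiableAt_const v)]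
    simp
  rw [e, e]
  exact (hf.isSymmSndFDerivAt (by
    simpa using (WithTop.coe_le_coe.2 le_top : ((2 : ℕ∞) : WithTop ℕ∞) ≤ ((⊤ : ℕ∞) : WithTop ℕ∞)))).eq w v

theorem pd_comm {f : Coord n → ℝ} (hf : ContDiffAt ℝ ∞ f x) (i j : Fin n) :
    pd i (pd j f) x = pd j (pd i f) x :=
  fderiv_fderiv_comm hf (coordVec j) (coordVec i)

/-- The commutator of a partial derivative and the derivative along a vector field. -/
theorem pd_fderiv_apply {f : Coord n → ℝ} {ξ : Coord n → Coord n} (hU : IsOpen U)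
    (hf : ContDiffOn ℝ ∞ f U) (hξ : ∀ k, ContDiffOn ℝ ∞ (fun y => ξ y k) U) (hx : x ∈ U)
    (i : Fin n) :
    pd i (fun y => fderiv ℝ f y (ξ y)) x
      = fderiv ℝ (pd i f) x (ξ x) + ∑ k, pd i (fun y => ξ y k) x * pd k f x := by
  have e : (fun y => fderiv ℝ f y (ξ y)) = fun y => ∑ k, ξ y k * pd k f y := by
    funext y; exact fderiv_eq_sum_pd f y (ξ y)
  have h1 : ∀ k, DifferentiableAt ℝ (fun y => ξ y k) x := fun k =>
    differentiableAt_of_contDiffOn hU (hξ k) hx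
  have h2 : ∀ k, DifferentiableAt ℝ (pd k f) x := fun k =>
    differentiableAt_of_contDiffOn hU (contDiffOn_pd hU hf k) hx
  rw [e, fderiv_eq_sum_pd (pd i f)]
  conv_lhs => rw [pd, fderiv_sum_apply (fun k _ => (h1 k).fun_mul (h2 k))]
  rw [← Finset.sum_add_distrib]
  refine Finset.sum_congr rfl fun k _ => ?_
  rw [fderiv_mul_apply (h1 k) (h2 k)]
  change ξ x k * pd i (pd k f) x + _ = _
  rw [pd_comm (hf.contDiffAt (hU.mem_nhds hx)) i k]
  rfl

end Calculus

/-! ## Derivatives of matrix valued functions -/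

section MatrixCalculus

variable {n : ℕ} {ι : Type*} [Fintype ι] {U : Set (Coord n)} {x : Coord n}

/-- The derivative of a matrix valued function along a vector, entry by entry. -/
def matDeriv (A : Coord n → Matrix ι ι ℝ) (x v : Coord n) : Matrix ι ι ℝ :=
  Matrix.of fun i j => fderiv ℝ (fun y => A y i j) x v

theorem matDeriv_mul {A B : Coord n → Matrix ι ι ℝ}
    (hA : ∀ i j, DifferentiableAt ℝ (fun y => A y i j) x)
    (hB : ∀ i j, DifferentiableAt ℝ (fun y => B y i j) x) (v : Coord n) :
    matDeriv (fun y => A y * B y) x v = A x * matDeriv B x v + matDeriv A x v * B x := by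
  ext i j
  simp only [matDeriv, Matrix.mul_apply, Matrix.of_apply, Matrix.add_apply]
  rw [fderiv_sum_apply (fun k _ => (hA i k).fun_mul (hB k j)), ← Finset.sum_add_distrib]
  exact Finset.sum_congr rfl fun k _ => fderiv_mul_apply (hA i k) (hB k j) v

variable [DecidableEq ι]

theorem contDiffOn_det {A : Coord n → Matrix ι ι ℝ}
    (hA : ∀ i j, ContDiffOn ℝ ∞ (fun y => A y i j) U) :
    ContDiffOn ℝ ∞ (fun y => (A y).det) U := by
  simp only [Matrix.det_apply]
  exact ContDiffOn.sum fun σ _ => (contDiffOn_prod fun i _ => hA (σ i) i).const_smul _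

/-- Cramer's rule: an entry of the inverse is a quotient of two determinants, hence smooth where the
denominator does not vanish. -/
theorem contDiffOn_inv_apply {A : Coord n → Matrix ι ι ℝ}
    (hA : ∀ i j, ContDiffOn ℝ ∞ (fun y => A y i j) U) (hd : ∀ y ∈ U, (A y).det ≠ 0) (i j : ι) :
    ContDiffOn ℝ ∞ (fun y => (A y)⁻¹ i j) U := by
  have e : (fun y => (A y)⁻¹ i j)
      = fun y => ((A y).det)⁻¹ * ((A y).updateRow j (Pi.single i 1)).det := by
    funext y
    rw [Matrix.inv_def, Ring.inverse_eq_inv', Matrix.smul_apply, Matrix.adjugate_apply, smul_eq_mul]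
  rw [e]
  refine ((contDiffOn_det hA).inv hd).mul (contDiffOn_det fun a b => ?_)
  by_cases h : a = j
  · subst h
    simpa using contDiffOn_const
  · simpa [Matrix.updateRow_apply, h] using hA a b

/-- Jacobi's formula for the derivative of a determinant. -/
theorem fderiv_det {A : Coord n → Matrix ι ι ℝ}
    (hA : ∀ i j, DifferentiableAt ℝ (fun y => A y i j) x) (v : Coord n) :
    fderiv ℝ (fun y => (A y).det) x v = ((A x).adjugate * matDeriv A x v).trace := by
  have h1 : ∀ σ : Equiv.Perm ι, HasFDerivAt (fun y => ∏ i, A y (σ i) i)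
      (∑ i, (∏ j ∈ Finset.univ.erase i, A x (σ j) j) • fderiv ℝ (fun y => A y (σ i) i) x) x :=
    fun σ => by
      simpa [← Finset.prod_fn] using
        HasFDerivAt.finsetProd fun i (_ : i ∈ Finset.univ) => (hA (σ i) i).hasFDerivAt
  have h2 : HasFDerivAt (fun y => (A y).det) (∑ σ : Equiv.Perm ι, (Equiv.Perm.sign σ : ℤ) •
      ∑ i, (∏ j ∈ Finset.univ.erase i, A x (σ j) j) • fderiv ℝ (fun y => A y (σ i) i) x) x := by
    simp only [Matrix.det_apply]
    exact HasFDerivAt.fun_sum fun σ _ => (h1 σ).const_smul _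
  -- By Cramer's rule the `i`-th diagonal entry is the determinant with column `i` differentiated;
  -- expanding it over permutations matches the product rule term by term.
  have h3 : ∀ i, ((A x).adjugate * matDeriv A x v) i i
      = ∑ σ : Equiv.Perm ι, (Equiv.Perm.sign σ : ℤ) •
        ((∏ j ∈ Finset.univ.erase i, A x (σ j) j) * matDeriv A x v (σ i) i) := by
    intro i
    have : ((A x).adjugate * matDeriv A x v) i i
        = ((A x).updateCol i (fun k => matDeriv A x v k i)).det := by
      rw [← Matrix.cramer_apply, Matrix.cramer_eq_adjugate_mulVec]
      rfl
    rw [this, Matrix.det_apply]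
    refine Finset.sum_congr rfl fun σ _ => ?_
    congr 1
    rw [← Finset.prod_erase_mul _ _ (Finset.mem_univ i)]
    congr 1
    · refine Finset.prod_congr rfl fun j hj => ?_
      rw [Matrix.updateCol_ne (Finset.ne_of_mem_erase hj)]
    · rw [Matrix.updateCol_self]
  rw [h2.fderiv, Matrix.trace]
  simp only [Matrix.diag_apply, h3]
  rw [Finset.sum_comm]
  simp [matDeriv, Finset.smul_sum]

end MatrixCalculus

/-! ## Metrics in coordinates and conformal vector fields -/

section Metric

variable {n : ℕ} {U : Set (Coord n)} {G : Coord n → Matrix (Fin n) (Fin n) ℝ} {x : Coord n}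
  {ξ : Coord n → Coord n} {ψ : Coord n → ℝ}

/-- `G` is a smooth field of nondegenerate symmetric matrices on the open set `U`. -/
structure IsMetricOn (G : Coord n → Matrix (Fin n) (Fin n) ℝ) (U : Set (Coord n)) : Prop where
  isOpen : IsOpen U
  contDiffOn : ∀ i j, ContDiffOn ℝ ∞ (fun y => G y i j) U
  symm : ∀ y ∈ U, (G y).transpose = G y
  det_ne_zero : ∀ y ∈ U, (G y).det ≠ 0

theorem IsMetricOn.inv (hG : IsMetricOn G U) (i j : Fin n) :
    ContDiffOn ℝ ∞ (fun y => (G y)⁻¹ i j) U :=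
  contDiffOn_inv_apply hG.contDiffOn hG.det_ne_zero i j

theorem IsMetricOn.inv_symm (hG : IsMetricOn G U) (hx : x ∈ U) (i j : Fin n) :
    (G x)⁻¹ i j = (G x)⁻¹ j i := by
  conv_lhs => rw [← hG.symm x hx, ← Matrix.transpose_nonsing_inv]
  rfl

theorem IsMetricOn.inv_mul (hG : IsMetricOn G U) (hx : x ∈ U) : (G x)⁻¹ * G x = 1 :=
  Matrix.nonsing_inv_mul _ (isUnit_iff_ne_zero.2 (hG.det_ne_zero x hx))

theorem IsMetricOn.mul_inv (hG : IsMetricOn G U) (hx : x ∈ U) : G x * (G x)⁻¹ = 1 :=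
  Matrix.mul_nonsing_inv _ (isUnit_iff_ne_zero.2 (hG.det_ne_zero x hx))

/-- Differentiate `g⁻¹ g = 1` and multiply by `g⁻¹` on the right. -/
theorem IsMetricOn.matDeriv_inv (hG : IsMetricOn G U) (hx : x ∈ U) (v : Coord n) :
    matDeriv (fun y => (G y)⁻¹) x v = -((G x)⁻¹ * matDeriv G x v * (G x)⁻¹) := by
  have h := matDeriv_mul (x := x)
    (fun i j => differentiableAt_of_contDiffOn hG.isOpen (hG.inv i j) hx)
    (fun i j => differentiableAt_of_contDiffOn hG.isOpen (hG.contDiffOn i j) hx) v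
  have h0 : matDeriv (fun y => (G y)⁻¹ * G y) x v = 0 := by
    ext i j
    simp only [matDeriv, Matrix.of_apply, Matrix.zero_apply]
    rw [fderiv_congr_on (f' := fun _ => (1 : Matrix (Fin n) (Fin n) ℝ) i j) hG.isOpen
      (fun y hy => by rw [hG.inv_mul hy]) hx]
    simp
  rw [h0] at h
  calc matDeriv (fun y => (G y)⁻¹) x v
      = matDeriv (fun y => (G y)⁻¹) x v * G x * (G x)⁻¹ := by
        rw [Matrix.mul_assoc, hG.mul_inv hx, Matrix.mul_one]
    _ = _ := by
        rw [← neg_eq_of_add_eq_zero_right h.symm, Matrix.neg_mul]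

theorem IsMetricOn.sqrtDet_pos (hG : IsMetricOn G U) (hx : x ∈ U) : 0 < sqrtDet G x :=
  Real.sqrt_pos.2 (abs_pos.2 (hG.det_ne_zero x hx))

theorem IsMetricOn.contDiffOn_sqrtDet (hG : IsMetricOn G U) : ContDiffOn ℝ ∞ (sqrtDet G) U := by
  intro y hy
  refine ContDiffWithinAt.sqrt ?_ (abs_ne_zero.2 (hG.det_ne_zero y hy))
  exact (contDiffOn_det hG.contDiffOn y hy).abs (hG.det_ne_zero y hy)

/-- The logarithm of the volume density `|g|^{1/2}`. -/
def logVol (G : Coord n → Matrix (Fin n) (Fin n) ℝ) (x : Coord n) : ℝ :=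
  Real.log (sqrtDet G x)

theorem IsMetricOn.contDiffOn_logVol (hG : IsMetricOn G U) : ContDiffOn ℝ ∞ (logVol G) U :=
  hG.contDiffOn_sqrtDet.log fun _ hy => (hG.sqrtDet_pos hy).ne'

theorem IsMetricOn.fderiv_sqrtDet (hG : IsMetricOn G U) (hx : x ∈ U) (v : Coord n) :
    fderiv ℝ (sqrtDet G) x v = sqrtDet G x * fderiv ℝ (logVol G) x v := by
  unfold logVol
  rw [fderiv.log (differentiableAt_of_contDiffOn hG.isOpen hG.contDiffOn_sqrtDet hx)
    (hG.sqrtDet_pos hx).ne']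
  simp [mul_inv_cancel_left₀ (hG.sqrtDet_pos hx).ne']

theorem IsMetricOn.fderiv_logVol (hG : IsMetricOn G U) (hx : x ∈ U) (v : Coord n) :
    fderiv ℝ (logVol G) x v = ((G x)⁻¹ * matDeriv G x v).trace / 2 := by
  -- `Real.log` ignores the sign of its argument, so the absolute value can be dropped and one
  -- formula serves every signature.
  have e : logVol G = fun y => Real.log (G y).det / 2 := by
    funext y
    rw [logVol, sqrtDet, Real.log_sqrt (abs_nonneg _), Real.log_abs]
  have hd := differentiableAt_of_contDiffOn hG.isOpen (contDiffOn_det hG.contDiffOn) hx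
  rw [e]
  simp only [div_eq_mul_inv]
  rw [fderiv_mul_const (hd.log (hG.det_ne_zero x hx)), fderiv.log hd (hG.det_ne_zero x hx)]
  simp only [_root_.smul_apply, smul_eq_mul]
  rw [fderiv_det fun i j => differentiableAt_of_contDiffOn hG.isOpen (hG.contDiffOn i j) hx,
    Matrix.inv_def, Ring.inverse_eq_inv', Matrix.smul_mul, Matrix.trace_smul, smul_eq_mul]
  ring

/-- The coefficient `|g|^{-1/2} (|g|^{1/2} g^{ij})_{,i}` of `u_j` in the Laplace operator. -/
def drift (G : Coord n → Matrix (Fin n) (Fin n) ℝ) (j : Fin n) (x : Coord n) : ℝ :=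
  (sqrtDet G x)⁻¹ * ∑ i, pd i (fun y => sqrtDet G y * (G y)⁻¹ i j) x

theorem IsMetricOn.contDiffOn_drift (hG : IsMetricOn G U) (j : Fin n) :
    ContDiffOn ℝ ∞ (drift G j) U :=
  (hG.contDiffOn_sqrtDet.inv fun _ hy => (hG.sqrtDet_pos hy).ne').mul
    (ContDiffOn.sum fun i _ => contDiffOn_pd hG.isOpen (hG.contDiffOn_sqrtDet.mul (hG.inv i j)) i)

/-- Expanding the product rule leaves only the logarithmic derivative of the density, which responds
linearly to a conformal field. -/
theorem IsMetricOn.drift_eq (hG : IsMetricOn G U) (hx : x ∈ U) (j : Fin n) :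
    drift G j x = ∑ i, (pd i (fun y => (G y)⁻¹ i j) x + pd i (logVol G) x * (G x)⁻¹ i j) := by
  rw [drift, Finset.mul_sum]
  refine Finset.sum_congr rfl fun i _ => ?_
  unfold pd
  rw [fderiv_mul_apply (differentiableAt_of_contDiffOn hG.isOpen hG.contDiffOn_sqrtDet hx)
    (differentiableAt_of_contDiffOn hG.isOpen (hG.inv i j) hx), hG.fderiv_sqrtDet hx]
  have := (hG.sqrtDet_pos hx).ne'
  field_simp

/-- The Jacobian matrix `ξⁱ_{,k}` of a vector field. -/
def jac (ξ : Coord n → Coord n) (x : Coord n) : Matrix (Fin n) (Fin n) ℝ :=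
  Matrix.of fun i k => pd k (fun y => ξ y i) x

/-- The Lie derivative of the inverse metric. -/
def lieInv (G : Coord n → Matrix (Fin n) (Fin n) ℝ) (ξ : Coord n → Coord n) (x : Coord n) :
    Matrix (Fin n) (Fin n) ℝ :=
  matDeriv (fun y => (G y)⁻¹) x (ξ x) - jac ξ x * (G x)⁻¹ - (G x)⁻¹ * (jac ξ x).transpose

theorem of_lieMetric (G : Coord n → Matrix (Fin n) (Fin n) ℝ) (ξ : Coord n → Coord n)
    (x : Coord n) : Matrix.of (fun i j => lieMetric G ξ i j x)
      = matDeriv G x (ξ x) + (jac ξ x).transpose * G x + G x * jac ξ x := by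
  ext i j
  simp only [lieMetric, Matrix.of_apply, Matrix.add_apply, matDeriv, jac, Matrix.mul_apply,
    Matrix.transpose_apply, fderiv_eq_sum_pd, Finset.sum_add_distrib]
  congr 2
  exact Finset.sum_congr rfl fun k _ => mul_comm _ _

theorem IsMetricOn.lieInv_eq (hG : IsMetricOn G U) (hx : x ∈ U) :
    lieInv G ξ x = -((G x)⁻¹ * Matrix.of (fun i j => lieMetric G ξ i j x) * (G x)⁻¹) := by
  rw [of_lieMetric, lieInv, hG.matDeriv_inv hx]
  have h1 := hG.mul_inv hx
  have h2 := hG.inv_mul hx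
  simp only [Matrix.mul_add, Matrix.add_mul, Matrix.mul_assoc, h1, Matrix.mul_one]
  rw [← Matrix.mul_assoc (G x)⁻¹ (G x), h2, Matrix.one_mul]
  abel

/-- Lowering both indices with `g` is invertible. The symmetry condition produces the raised form,
since `g^{ij}` is the symbol of the equation, while conformal Killing vectors are defined by the
lowered one. -/
theorem IsMetricOn.lieInv_eq_iff (hG : IsMetricOn G U) (hx : x ∈ U) (c : ℝ) :
    lieInv G ξ x = -(c • (G x)⁻¹) ↔ ∀ i j, lieMetric G ξ i j x = c * G x i j := by
  have key : Matrix.of (fun i j => lieMetric G ξ i j x) = -(G x * lieInv G ξ x * G x) := by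
    have h1 := hG.mul_inv hx
    have h2 := hG.inv_mul hx
    rw [hG.lieInv_eq hx]
    simp only [Matrix.mul_neg, Matrix.neg_mul, neg_neg, Matrix.mul_assoc, h2, Matrix.mul_one]
    rw [← Matrix.mul_assoc, h1, Matrix.one_mul]
  constructor
  · intro h i j
    have := congrFun (congrFun key i) j
    rw [h] at this
    simp only [Matrix.mul_neg, Matrix.neg_mul, neg_neg, Matrix.mul_smul, Matrix.smul_mul,
      Matrix.mul_assoc, hG.inv_mul hx, Matrix.mul_one] at this
    exact this
  · intro h
    rw [hG.lieInv_eq hx]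
    have : Matrix.of (fun i j => lieMetric G ξ i j x) = c • G x := by
      ext i j
      exact h i j
    rw [this, Matrix.mul_smul, Matrix.smul_mul, hG.inv_mul hx, Matrix.one_mul]

/-- The conformal factor as a trace. -/
def confFactor (G : Coord n → Matrix (Fin n) (Fin n) ℝ) (ξ : Coord n → Coord n)
    (x : Coord n) : ℝ :=
  (2 * (n : ℝ))⁻¹ * ∑ i, ∑ j, (G x)⁻¹ i j * lieMetric G ξ j i x

theorem IsMetricOn.trace_conformal (hG : IsMetricOn G U) (hx : x ∈ U) {c : ℝ}
    (h : ∀ i j, lieMetric G ξ i j x = c * G x i j) :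
    ∑ i, ∑ j, (G x)⁻¹ i j * lieMetric G ξ j i x = n * c := by
  have : ∀ i, ∑ j, (G x)⁻¹ i j * lieMetric G ξ j i x = c := by
    intro i
    have h1 := congrFun (congrFun (hG.inv_mul hx) i) i
    rw [Matrix.mul_apply, Matrix.one_apply_eq] at h1
    simp only [h]
    calc _ = c * ∑ j, (G x)⁻¹ i j * G x j i := by
          rw [Finset.mul_sum]; exact Finset.sum_congr rfl fun j _ => by ring
      _ = c := by rw [h1, mul_one]
  simp [this]

theorem IsMetricOn.confFactor_eq (hG : IsMetricOn G U) (hx : x ∈ U) (hn : n ≠ 0) {c : ℝ}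
    (h : ∀ i j, lieMetric G ξ i j x = 2 * c * G x i j) : confFactor G ξ x = c := by
  rw [confFactor, hG.trace_conformal hx h]
  have : (n : ℝ) ≠ 0 := Nat.cast_ne_zero.2 hn
  field_simp

theorem IsMetricOn.contDiffOn_confFactor (hG : IsMetricOn G U)
    (hξ : ∀ k, ContDiffOn ℝ ∞ (fun y => ξ y k) U) : ContDiffOn ℝ ∞ (confFactor G ξ) U := by
  refine contDiffOn_const.mul (ContDiffOn.sum fun i _ => ContDiffOn.sum fun j _ =>
    (hG.inv i j).mul (ContDiffOn.sum fun k _ => ?_))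
  have h1 := (hξ k).mul (contDiffOn_pd hG.isOpen (hG.contDiffOn j i) k)
  have h2 := (hG.contDiffOn k i).mul (contDiffOn_pd hG.isOpen (hξ k) j)
  have h3 := (hG.contDiffOn j k).mul (contDiffOn_pd hG.isOpen (hξ k) i)
  exact (h1.add h2).add h3

/-- The divergence `ξⁱ_{,i}` of the components of a vector field. -/
def coordDiv (ξ : Coord n → Coord n) (x : Coord n) : ℝ := ∑ i, pd i (fun y => ξ y i) x

/-- Half the `g`-trace of the conformal Killing equation: each of the two Jacobian terms contributes
one divergence. -/
theorem IsMetricOn.fderiv_logVol_conformal (hG : IsMetricOn G U) (hx : x ∈ U) {c : ℝ}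
    (h : ∀ i j, lieMetric G ξ i j x = 2 * c * G x i j) :
    fderiv ℝ (logVol G) x (ξ x) = n * c - coordDiv ξ x := by
  have h1 : matDeriv G x (ξ x)
      = (2 * c) • G x - (jac ξ x).transpose * G x - G x * jac ξ x := by
    have h2 := of_lieMetric G ξ x
    have h3 : Matrix.of (fun i j => lieMetric G ξ i j x) = (2 * c) • G x := by
      ext i j; exact h i j
    rw [h3] at h2
    rw [h2]; abel
  rw [hG.fderiv_logVol hx, h1]
  simp only [Matrix.mul_sub, Matrix.trace_sub, Matrix.mul_smul, Matrix.trace_smul, hG.inv_mul hx]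
  rw [Matrix.trace_mul_comm _ ((jac ξ x).transpose * G x), Matrix.mul_assoc, hG.mul_inv hx,
    ← Matrix.mul_assoc, hG.inv_mul hx, Matrix.mul_one, Matrix.one_mul, Matrix.trace_transpose]
  have h4 : (jac ξ x).trace = coordDiv ξ x := rfl
  rw [h4]
  simp
  ring

/-- The raised conformal Killing equation, solved for the directional derivative of `g^{ij}` so that
it can be differentiated once more. -/
theorem IsMetricOn.fderiv_inv_conformal (hG : IsMetricOn G U) (hx : x ∈ U) {c : ℝ}
    (h : ∀ i j, lieMetric G ξ i j x = 2 * c * G x i j) (i j : Fin n) :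
    fderiv ℝ (fun y => (G y)⁻¹ i j) x (ξ x)
      = ∑ k, (pd k (fun y => ξ y i) x * (G x)⁻¹ k j + (G x)⁻¹ i k * pd k (fun y => ξ y j) x)
        - 2 * c * (G x)⁻¹ i j := by
  have h1 := congrFun (congrFun ((hG.lieInv_eq_iff hx (2 * c)).2 h) i) j
  simp only [lieInv, Matrix.sub_apply, matDeriv, Matrix.of_apply, Matrix.mul_apply, jac,
    Matrix.neg_apply, Matrix.smul_apply, smul_eq_mul, Matrix.transpose_apply] at h1
  rw [Finset.sum_add_distrib]
  linarith

end Metric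

/-! ### The first order coefficients of the Laplacian under a conformal field -/

section DriftIdentity

variable {n : ℕ} {U : Set (Coord n)} {G : Coord n → Matrix (Fin n) (Fin n) ℝ} {x : Coord n}
  {ξ : Coord n → Coord n} {ψ : Coord n → ℝ}

/-- The algebraic identity behind `IsMetricOn.fderiv_drift_conformal`. -/
theorem drift_index_identity (h a : Fin n → Fin n → ℝ) (dh : Fin n → Fin n → Fin n → ℝ)
    (b : Fin n → Fin n → Fin n → ℝ) (hb : ∀ i k l, b i k l = b k i l) (s dψ : Fin n → ℝ)
    (c : ℝ) (j : Fin n) :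
    ∑ i, ((∑ k, (b i k i * h k j + a i k * dh i k j + (dh i i k * a j k + h i k * b i k j))
          - (2 * dψ i * h i j + 2 * c * dh i i j) - ∑ k, a k i * dh k i j)
        + (s i * (∑ k, (a i k * h k j + h i k * a j k) - 2 * c * h i j)
          + (n * dψ i - ∑ k, b i k k - ∑ k, a k i * s k) * h i j))
      = ∑ k, (∑ i, (dh i i k + s i * h i k)) * a j k - 2 * c * ∑ i, (dh i i j + s i * h i j)
        + ∑ i, ∑ k, h i k * b i k j + (n - 2) * ∑ i, dψ i * h i j := by
  -- The gradient of the divergence of the field appears once from `g^{ij}` and once from the volume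
  -- density; symmetry of second derivatives makes the two cancel.
  have e1 : ∑ i, ∑ k, b i k i * h k j = ∑ i, ∑ k, b i k k * h i j := by
    rw [Finset.sum_comm]
    exact Finset.sum_congr rfl fun i _ => Finset.sum_congr rfl fun k _ => by rw [hb]
  have e2 : ∑ i, ∑ k, a i k * dh i k j = ∑ i, ∑ k, a k i * dh k i j := Finset.sum_comm
  have e3 : ∑ i, ∑ k, s i * (a i k * h k j) = ∑ i, ∑ k, a k i * s k * h i j := by
    rw [Finset.sum_comm]
    exact Finset.sum_congr rfl fun i _ => Finset.sum_congr rfl fun k _ => by ring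
  have e4 : ∑ i, ∑ k, dh i i k * a j k = ∑ k, ∑ i, dh i i k * a j k := Finset.sum_comm
  have e5 : ∑ i, ∑ k, s i * (h i k * a j k) = ∑ k, ∑ i, s i * h i k * a j k := by
    rw [Finset.sum_comm]
    exact Finset.sum_congr rfl fun i _ => Finset.sum_congr rfl fun k _ => by ring
  have e6 : ∑ i, s i * (2 * c * h i j) = 2 * c * ∑ i, s i * h i j := by
    rw [Finset.mul_sum]
    exact Finset.sum_congr rfl fun i _ => by ring
  have e7 : ∑ i, 2 * dψ i * h i j = 2 * ∑ i, dψ i * h i j := by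
    rw [Finset.mul_sum]
    exact Finset.sum_congr rfl fun i _ => by ring
  have e8 : ∑ i, n * dψ i * h i j = n * ∑ i, dψ i * h i j := by
    rw [Finset.mul_sum]
    exact Finset.sum_congr rfl fun i _ => by ring
  simp only [Finset.sum_add_distrib, Finset.sum_sub_distrib, Finset.sum_mul, mul_sub, sub_mul,
    add_mul, mul_add, ← Finset.mul_sum _ _ (2 * c)] at *
  simp only [Finset.mul_sum _ _ (s _)] at *
  linarith

/-- How the first order coefficients of the Laplace operator change along a conformal vector
field. -/
theorem IsMetricOn.fderiv_drift_conformal (hG : IsMetricOn G U)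
    (hξ : ∀ k, ContDiffOn ℝ ∞ (fun y => ξ y k) U) (hψ : ContDiffOn ℝ ∞ ψ U)
    (hC : ∀ y ∈ U, ∀ i j, lieMetric G ξ i j y = 2 * ψ y * G y i j) (hx : x ∈ U) (j : Fin n) :
    fderiv ℝ (drift G j) x (ξ x)
      = ∑ k, drift G k x * pd k (fun y => ξ y j) x - 2 * ψ x * drift G j x
        + ∑ i, ∑ k, (G x)⁻¹ i k * pd i (pd k (fun y => ξ y j)) x
        + (n - 2) * ∑ i, pd i ψ x * (G x)⁻¹ i j := by
  have hU := hG.isOpen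
  have hd : ∀ {f : Coord n → ℝ}, ContDiffOn ℝ ∞ f U → DifferentiableAt ℝ f x := fun hf =>
    differentiableAt_of_contDiffOn hU hf hx
  have hh := hG.inv
  have hl := hG.contDiffOn_logVol
  have hp : ∀ {f : Coord n → ℝ}, ContDiffOn ℝ ∞ f U → ∀ i, ContDiffOn ℝ ∞ (pd i f) U :=
    fun hf i => contDiffOn_pd hU hf i
  -- The conformal equation holds on all of `U`, so it may be differentiated by `∂_i`. Commuting
  -- `∂_i` with the derivative along `ξ` costs the last sum.
  have h1 : ∀ i, fderiv ℝ (pd i fun y => (G y)⁻¹ i j) x (ξ x)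
      = (∑ k, (pd i (pd k fun y => ξ y i) x * (G x)⁻¹ k j
            + pd k (fun y => ξ y i) x * pd i (fun y => (G y)⁻¹ k j) x
          + (pd i (fun y => (G y)⁻¹ i k) x * pd k (fun y => ξ y j) x
            + (G x)⁻¹ i k * pd i (pd k fun y => ξ y j) x))
          - (2 * pd i ψ x * (G x)⁻¹ i j + 2 * ψ x * pd i (fun y => (G y)⁻¹ i j) x)
          - ∑ k, pd i (fun y => ξ y k) x * pd k (fun y => (G y)⁻¹ i j) x) := by
    intro i
    have e := pd_fderiv_apply hU (hh i j) hξ hx i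
    rw [pd_congr hU (fun y hy => hG.fderiv_inv_conformal hy (hC y hy) i j) hx i] at e
    rw [← sub_eq_iff_eq_add.2 e]
    congr 1
    rw [pd_sub (hd (ContDiffOn.sum fun k _ =>
        ((hp (hξ i) k).mul (hh k j)).add ((hh i k).mul (hp (hξ j) k))))
      (hd ((contDiffOn_const.mul hψ).mul (hh i j))),
      pd_sum fun k _ => hd (((hp (hξ i) k).mul (hh k j)).add ((hh i k).mul (hp (hξ j) k))),
      pd_mul (hd (contDiffOn_const.mul hψ)) (hd (hh i j)), pd_const_mul (hd hψ)]
    congr 1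
    · refine Finset.sum_congr rfl fun k _ => ?_
      rw [pd_add (hd ((hp (hξ i) k).mul (hh k j))) (hd ((hh i k).mul (hp (hξ j) k))),
        pd_mul (hd (hp (hξ i) k)) (hd (hh k j)), pd_mul (hd (hh i k)) (hd (hp (hξ j) k))]
      ring
    · ring
  -- The same for the density. The `n` in the factor `n - 2` of the result comes from here, the `-2`
  -- from `h1`.
  have h2 : ∀ i, fderiv ℝ (pd i (logVol G)) x (ξ x)
      = n * pd i ψ x - ∑ k, pd i (pd k fun y => ξ y k) x
        - ∑ k, pd i (fun y => ξ y k) x * pd k (logVol G) x := by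
    intro i
    have e := pd_fderiv_apply hU hl hξ hx i
    rw [pd_congr hU (fun y hy => hG.fderiv_logVol_conformal hy (hC y hy)) hx i] at e
    rw [← sub_eq_iff_eq_add.2 e]
    congr 1
    unfold coordDiv
    rw [pd_sub ((hd hψ).const_mul _) (hd (ContDiffOn.sum fun k _ => hp (hξ k) k)),
      pd_const_mul (hd hψ), pd_sum fun k _ => hd (hp (hξ k) k)]
  rw [fderiv_congr_on hU (fun y hy => hG.drift_eq hy j) hx,
    fderiv_sum_apply fun i _ => hd ((hp (hh i j) i).add ((hp hl i).mul (hh i j)))]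
  simp only [hG.drift_eq hx]
  rw [← drift_index_identity (fun i k => (G x)⁻¹ i k) (fun i k => pd k (fun y => ξ y i) x)
    (fun l i k => pd l (fun y => (G y)⁻¹ i k) x) (fun i k l => pd i (pd k fun y => ξ y l) x)
    (fun i k l => pd_comm ((hξ l).contDiffAt (hU.mem_nhds hx)) i k)
    (fun i => pd i (logVol G) x) (fun i => pd i ψ x) (ψ x) j]
  refine Finset.sum_congr rfl fun i _ => ?_
  rw [fderiv_add_apply (hd (hp (hh i j) i)) (hd ((hp hl i).mul (hh i j))),
    fderiv_mul_apply (hd (hp hl i)) (hd (hh i j)), h1, h2,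
    hG.fderiv_inv_conformal hx (hC x hx) i j]

end DriftIdentity

/-! ## The second prolongation -/

section Prolongation

variable {n : ℕ} {U : Set (Coord n)} {G : Coord n → Matrix (Fin n) (Fin n) ℝ}
  {V : Coord n → ℝ} {ξ : Jet0 n → Coord n} {η : Jet0 n → ℝ}

/-- The partial derivative `F_{,i}` of a function of `(x, u)`. -/
def pdx (i : Fin n) (F : Jet0 n → ℝ) (z : Jet0 n) : ℝ := fderiv ℝ F z (coordVec i, 0)

/-- The partial derivative `F_u` of a function of `(x, u)`. -/
def pdu (F : Jet0 n → ℝ) (z : Jet0 n) : ℝ := fderiv ℝ F z (0, 1)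

theorem totalDeriv0_eq (i : Fin n) (F : Jet0 n → ℝ) (J : Jet1 n) :
    totalDeriv0 i F J = pdx i F (J.1, J.2.1) + J.2.2 i * pdu F (J.1, J.2.1) := by
  have : ((coordVec i, J.2.2 i) : Jet0 n) = (coordVec i, 0) + J.2.2 i • (0, 1) := by
    ext <;> simp
  rw [totalDeriv0, this, map_add, map_smul]
  rfl

theorem isOpen_cylinder (hU : IsOpen U) : IsOpen (U ×ˢ (Set.univ : Set ℝ)) :=
  hU.prod isOpen_univ

theorem contDiffOn_pdx {F : Jet0 n → ℝ} (hU : IsOpen U)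
    (hF : ContDiffOn ℝ ∞ F (U ×ˢ Set.univ)) (i : Fin n) :
    ContDiffOn ℝ ∞ (pdx i F) (U ×ˢ Set.univ) :=
  (hF.fderiv_of_isOpen (isOpen_cylinder hU) (by simp)).clm_apply contDiffOn_const

theorem contDiffOn_pdu {F : Jet0 n → ℝ} (hU : IsOpen U)
    (hF : ContDiffOn ℝ ∞ F (U ×ˢ Set.univ)) :
    ContDiffOn ℝ ∞ (pdu F) (U ×ˢ Set.univ) :=
  (hF.fderiv_of_isOpen (isOpen_cylinder hU) (by simp)).clm_apply contDiffOn_const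

theorem differentiableAt_of_cylinder {F : Jet0 n → ℝ} (hU : IsOpen U)
    (hF : ContDiffOn ℝ ∞ F (U ×ˢ Set.univ)) {z : Jet0 n} (hz : z.1 ∈ U) :
    DifferentiableAt ℝ F z :=
  (hF.contDiffAt ((isOpen_cylinder hU).mem_nhds ⟨hz, trivial⟩)).differentiableAt (by simp)

theorem hasFDerivAt_lift {F : Jet0 n → ℝ} {J : Jet1 n}
    (hF : DifferentiableAt ℝ F (J.1, J.2.1)) :
    HasFDerivAt (fun J : Jet1 n => F (J.1, J.2.1))
      ((fderiv ℝ F (J.1, J.2.1)).comp ((ContinuousLinearMap.fst ℝ _ _).prod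
        ((ContinuousLinearMap.fst ℝ _ _).comp (ContinuousLinearMap.snd ℝ _ _)))) J :=
  HasFDerivAt.comp (f := fun J : Jet1 n => (J.1, J.2.1)) J hF.hasFDerivAt
    (((ContinuousLinearMap.fst ℝ (Coord n) (ℝ × (Fin n → ℝ))).prod
        ((ContinuousLinearMap.fst ℝ ℝ (Fin n → ℝ)).comp
          (ContinuousLinearMap.snd ℝ (Coord n) (ℝ × (Fin n → ℝ))))).hasFDerivAt)

theorem hasFDerivAt_momentum (k : Fin n) (J : Jet1 n) :
    HasFDerivAt (fun J : Jet1 n => J.2.2 k)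
      ((ContinuousLinearMap.proj k).comp ((ContinuousLinearMap.snd ℝ ℝ (Fin n → ℝ)).comp
        (ContinuousLinearMap.snd ℝ (Coord n) (ℝ × (Fin n → ℝ))))) J :=
  ((ContinuousLinearMap.proj (R := ℝ) (φ := fun _ : Fin n => ℝ) k).comp
    ((ContinuousLinearMap.snd ℝ ℝ (Fin n → ℝ)).comp
        (ContinuousLinearMap.snd ℝ (Coord n) (ℝ × (Fin n → ℝ))))).hasFDerivAt

theorem eta1_eq (ξ : Jet0 n → Coord n) (η : Jet0 n → ℝ) (i : Fin n) (J : Jet1 n) :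
    eta1 ξ η i J = pdx i η (J.1, J.2.1) + J.2.2 i * pdu η (J.1, J.2.1)
      - ∑ k, J.2.2 k * (pdx i (fun z => ξ z k) (J.1, J.2.1)
        + J.2.2 i * pdu (fun z => ξ z k) (J.1, J.2.1)) := by
  simp only [eta1, totalDeriv0_eq]

/-- The coefficients `η_[ij]` in terms of partial derivatives with respect to `xⁱ` and `u`. -/
theorem eta2_eq (hU : IsOpen U) (hξ : ∀ k, ContDiffOn ℝ ∞ (fun z => ξ z k) (U ×ˢ Set.univ))
    (hη : ContDiffOn ℝ ∞ η (U ×ˢ Set.univ)) (i j : Fin n) (x : Coord n) (hx : x ∈ U) (u : ℝ)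
    (p : Fin n → ℝ) (q : Fin n → Fin n → ℝ) :
    eta2 ξ η i j (x, u, p, q)
      = totalDeriv0 j (pdx i η) (x, u, p) + (p i * totalDeriv0 j (pdu η) (x, u, p)
          + q j i * pdu η (x, u))
        - ∑ k, (p k * (totalDeriv0 j (pdx i fun z => ξ z k) (x, u, p)
              + (p i * totalDeriv0 j (pdu fun z => ξ z k) (x, u, p)
                + q j i * pdu (fun z => ξ z k) (x, u)))
            + q j k * (pdx i (fun z => ξ z k) (x, u) + p i * pdu (fun z => ξ z k) (x, u)))
        - ∑ k, q i k * totalDeriv0 j (fun z => ξ z k) (x, u, p) := by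
  rw [eta2]
  congr 1
  have e : eta1 ξ η i = fun J => pdx i η (J.1, J.2.1) + J.2.2 i * pdu η (J.1, J.2.1)
      - ∑ k, J.2.2 k * (pdx i (fun z => ξ z k) (J.1, J.2.1)
        + J.2.2 i * pdu (fun z => ξ z k) (J.1, J.2.1)) := funext fun J => eta1_eq ξ η i J
  have hl : ∀ {F : Jet0 n → ℝ}, ContDiffOn ℝ ∞ F (U ×ˢ Set.univ) →
      DifferentiableAt ℝ (fun J : Jet1 n => F (J.1, J.2.1)) (x, u, p) := fun hF =>
    (hasFDerivAt_lift (differentiableAt_of_cylinder hU hF hx)).differentiableAt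
  have hl' : ∀ {F : Jet0 n → ℝ}, ContDiffOn ℝ ∞ F (U ×ˢ Set.univ) →
      fderiv ℝ (fun J : Jet1 n => F (J.1, J.2.1)) (x, u, p) (coordVec j, p j, q j)
        = totalDeriv0 j F (x, u, p) := fun hF => by
    rw [(hasFDerivAt_lift (differentiableAt_of_cylinder hU hF hx)).fderiv]; rfl
  have hm : ∀ k, DifferentiableAt ℝ (fun J : Jet1 n => J.2.2 k) (x, u, p) := fun k =>
    (hasFDerivAt_momentum k _).differentiableAt
  have hm' : ∀ k, fderiv ℝ (fun J : Jet1 n => J.2.2 k) (x, u, p) (coordVec j, p j, q j)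
      = q j k := fun k => by rw [(hasFDerivAt_momentum k _).fderiv]; rfl
  have hηx := contDiffOn_pdx hU hη i
  have hηu := contDiffOn_pdu hU hη
  have hξx := fun k => contDiffOn_pdx hU (hξ k) i
  have hξu := fun k => contDiffOn_pdu hU (hξ k)
  have hs : ∀ k, DifferentiableAt ℝ (fun J : Jet1 n => pdx i (fun z => ξ z k) (J.1, J.2.1)
        + J.2.2 i * pdu (fun z => ξ z k) (J.1, J.2.1)) (x, u, p) := fun k =>
    (hl (hξx k)).fun_add ((hm i).fun_mul (hl (hξu k)))
  change fderiv ℝ (eta1 ξ η i) (x, u, p) (coordVec j, p j, q j) = _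
  rw [e, fderiv_sub_apply ((hl hηx).fun_add ((hm i).fun_mul (hl hηu)))
      (DifferentiableAt.fun_sum fun k _ => (hm k).fun_mul (hs k)),
    fderiv_add_apply (hl hηx) ((hm i).fun_mul (hl hηu)), fderiv_mul_apply (hm i) (hl hηu),
    fderiv_sum_apply fun k _ => (hm k).fun_mul (hs k), hl' hηx, hl' hηu, hm']
  congr 1
  refine Finset.sum_congr rfl fun k _ => ?_
  rw [fderiv_mul_apply (hm k) (hs k), fderiv_add_apply (hl (hξx k)) ((hm i).fun_mul (hl (hξu k))),
    fderiv_mul_apply (hm i) (hl (hξu k)), hl' (hξx k), hl' (hξu k), hm', hm']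

theorem kgFun_eq (G : Coord n → Matrix (Fin n) (Fin n) ℝ) (V : Coord n → ℝ) (J : Jet2 n) :
    kgFun G V J = (∑ i, ∑ j, (G J.1)⁻¹ i j * J.2.2.2 i j) + (∑ j, drift G j J.1 * J.2.2.1 j)
      - V J.1 * J.2.1 := rfl

/-- The derivative of `kgFun` in an arbitrary direction. -/
theorem fderiv_kgFun (hG : IsMetricOn G U) (hV : ContDiffOn ℝ ∞ V U) (J w : Jet2 n)
    (hJ : J.1 ∈ U) :
    fderiv ℝ (kgFun G V) J w
      = (∑ i, ∑ j, ((G J.1)⁻¹ i j * w.2.2.2 i j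
          + fderiv ℝ (fun y => (G y)⁻¹ i j) J.1 w.1 * J.2.2.2 i j))
        + (∑ j, (drift G j J.1 * w.2.2.1 j + fderiv ℝ (drift G j) J.1 w.1 * J.2.2.1 j))
        - (V J.1 * w.2.1 + fderiv ℝ V J.1 w.1 * J.2.1) := by
  have hb : ∀ {f : Coord n → ℝ}, ContDiffOn ℝ ∞ f U →
      HasFDerivAt (fun J : Jet2 n => f J.1)
        ((fderiv ℝ f J.1).comp (ContinuousLinearMap.fst ℝ _ _)) J := fun hf =>
    HasFDerivAt.comp (f := fun J : Jet2 n => J.1) J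
      (differentiableAt_of_contDiffOn hG.isOpen hf hJ).hasFDerivAt hasFDerivAt_fst
  have hd : ∀ {f : Coord n → ℝ}, ContDiffOn ℝ ∞ f U →
      DifferentiableAt ℝ (fun J : Jet2 n => f J.1) J := fun hf => (hb hf).differentiableAt
  have hd' : ∀ {f : Coord n → ℝ}, ContDiffOn ℝ ∞ f U →
      fderiv ℝ (fun J : Jet2 n => f J.1) J w = fderiv ℝ f J.1 w.1 := fun hf => by
    rw [(hb hf).fderiv]; rfl
  let s₁ := ContinuousLinearMap.snd ℝ (Coord n) (ℝ × (Fin n → ℝ) × (Fin n → Fin n → ℝ))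
  let s₂ := (ContinuousLinearMap.snd ℝ ℝ ((Fin n → ℝ) × (Fin n → Fin n → ℝ))).comp s₁
  let cu : Jet2 n →L[ℝ] ℝ := (ContinuousLinearMap.fst ℝ _ _).comp s₁
  let cp : Fin n → Jet2 n →L[ℝ] ℝ := fun k =>
    (ContinuousLinearMap.proj (R := ℝ) (φ := fun _ : Fin n => ℝ) k).comp
      ((ContinuousLinearMap.fst ℝ _ _).comp s₂)
  let cq : Fin n → Fin n → Jet2 n →L[ℝ] ℝ := fun i j =>
    (ContinuousLinearMap.proj (R := ℝ) (φ := fun _ : Fin n => ℝ) j).comp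
      ((ContinuousLinearMap.proj (R := ℝ) (φ := fun _ : Fin n => Fin n → ℝ) i).comp
        ((ContinuousLinearMap.snd ℝ _ _).comp s₂))
  have hu : HasFDerivAt (fun J : Jet2 n => J.2.1) cu J := cu.hasFDerivAt
  have hp : ∀ k, HasFDerivAt (fun J : Jet2 n => J.2.2.1 k) (cp k) J :=
    fun k => (cp k).hasFDerivAt
  have hq : ∀ i j, HasFDerivAt (fun J : Jet2 n => J.2.2.2 i j) (cq i j) J :=
    fun i j => (cq i j).hasFDerivAt
  have h1 : ∀ i j, DifferentiableAt ℝ (fun J : Jet2 n => (G J.1)⁻¹ i j * J.2.2.2 i j) J :=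
    fun i j => (hd (hG.inv i j)).fun_mul (hq i j).differentiableAt
  have h2 : ∀ j, DifferentiableAt ℝ (fun J : Jet2 n => drift G j J.1 * J.2.2.1 j) J :=
    fun j => (hd (hG.contDiffOn_drift j)).fun_mul (hp j).differentiableAt
  have h1' := fun i => DifferentiableAt.fun_sum (u := Finset.univ) fun j _ => h1 i j
  have h3 := DifferentiableAt.fun_sum (u := Finset.univ) fun i _ => h1' i
  have h4 := DifferentiableAt.fun_sum (u := Finset.univ) fun j _ => h2 j
  have e : kgFun G V = fun J => (∑ i, ∑ j, (G J.1)⁻¹ i j * J.2.2.2 i j)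
      + (∑ j, drift G j J.1 * J.2.2.1 j) - V J.1 * J.2.1 := rfl
  rw [e, fderiv_sub_apply (h3.fun_add h4) ((hd hV).fun_mul hu.differentiableAt),
    fderiv_add_apply h3 h4, fderiv_sum_apply fun i _ => h1' i, fderiv_sum_apply fun j _ => h2 j,
    fderiv_mul_apply (hd hV) hu.differentiableAt, hd' hV, hu.fderiv]
  congr 2
  · refine Finset.sum_congr rfl fun i _ => ?_
    rw [fderiv_sum_apply fun j _ => h1 i j]
    refine Finset.sum_congr rfl fun j _ => ?_
    rw [fderiv_mul_apply (hd (hG.inv i j)) (hq i j).differentiableAt, hd' (hG.inv i j),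
      (hq i j).fderiv]
    rfl
  · refine Finset.sum_congr rfl fun j _ => ?_
    rw [fderiv_mul_apply (hd (hG.contDiffOn_drift j)) (hp j).differentiableAt,
      hd' (hG.contDiffOn_drift j), (hp j).fderiv]
    rfl

end Prolongation

/-! ## Algebra of polynomial identities in the jet variables -/

section Algebra

variable {n : ℕ}

theorem sum_mul_single_add_single (A : Fin n → Fin n → ℝ) (a b : Fin n) :
    ∑ i, ∑ j, A i j * ((if i = a ∧ j = b then 1 else 0) + (if i = b ∧ j = a then 1 else 0))
      = A a b + A b a := by
  simp [mul_add, Finset.sum_add_distrib, ite_and]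

/-- An affine function of symmetric matrices that vanishes on an affine hyperplane
`h : q = c` is a multiple of the equation of the hyperplane. -/
theorem symmetrized_eq_of_vanish (hn : n ≠ 0) {A : Fin n → Fin n → ℝ}
    {h g : Matrix (Fin n) (Fin n) ℝ} (hh : h.transpose = h) (hg : g.transpose = g)
    (hhg : h * g = 1) {K c : ℝ}
    (H : ∀ q : Fin n → Fin n → ℝ, (∀ i j, q i j = q j i) → ∑ i, ∑ j, h i j * q i j = c →
      K + ∑ i, ∑ j, A i j * q i j = 0) :
    (∀ a b, A a b + A b a = 2 * ((n : ℝ)⁻¹ * ∑ i, ∑ j, A i j * g i j) * h a b) ∧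
      K + ((n : ℝ)⁻¹ * ∑ i, ∑ j, A i j * g i j) * c = 0 := by
  have hn' : (n : ℝ) ≠ 0 := Nat.cast_ne_zero.2 hn
  have hgs : ∀ i j, g i j = g j i := fun i j => congrFun (congrFun hg j) i
  have hhs : ∀ i j, h i j = h j i := fun i j => congrFun (congrFun hh j) i
  have htr : ∑ i, ∑ j, h i j * g i j = n := by
    have : ∀ i, ∑ j, h i j * g i j = 1 := by
      intro i
      have e := congrFun (congrFun hhg i) i
      rw [Matrix.mul_apply, Matrix.one_apply_eq] at e
      rw [← e]
      exact Finset.sum_congr rfl fun j _ => by rw [hgs]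
    simp [this]
  have lin : ∀ (B q r : Fin n → Fin n → ℝ) (t : ℝ), ∑ i, ∑ j, B i j * (q i j + t * r i j)
      = ∑ i, ∑ j, B i j * q i j + t * ∑ i, ∑ j, B i j * r i j := by
    intro B q r t
    simp only [mul_add, Finset.sum_add_distrib, Finset.mul_sum]
    congr 1
    exact Finset.sum_congr rfl fun i _ => Finset.sum_congr rfl fun j _ => by ring
  -- Since `h : g = n`, adding the multiple `(c - h : s) / n` of `g` moves an arbitrary symmetric
  -- `s` onto the hyperplane, where the hypothesis applies.
  have key : ∀ s : Fin n → Fin n → ℝ, (∀ i j, s i j = s j i) →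
      K + (∑ i, ∑ j, A i j * s i j + ((c - ∑ i, ∑ j, h i j * s i j) / n)
        * ∑ i, ∑ j, A i j * g i j) = 0 := by
    intro s hs
    rw [← lin A s fun i j => g i j]
    refine H _ (fun i j => by rw [hs, hgs]) ?_
    rw [lin (fun i j => h i j) s fun i j => g i j, htr]
    field_simp
    ring
  have h0 := key (fun _ _ => 0) fun _ _ => rfl
  simp only [mul_zero, Finset.sum_const_zero, zero_add, sub_zero] at h0
  refine ⟨fun a b => ?_, ?_⟩
  -- The symmetrized elementary matrix, equal to twice the elementary one when `a = b`, reads off `A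
  -- a b + A b a`.
  · have h1 := key (fun i j => (if i = a ∧ j = b then 1 else 0) + (if i = b ∧ j = a then 1 else 0))
      fun i j => by simp only [and_comm, add_comm]
    rw [sum_mul_single_add_single, sum_mul_single_add_single h, hhs b a] at h1
    have : K = -(c / n * ∑ i, ∑ j, A i j * g i j) := by linarith
    rw [this] at h1
    field_simp at h1 ⊢
    linarith
  · rw [← h0]
    field_simp

/-- A nondegenerate matrix of size at least two is not a multiple of a square `v ⊗ v`. -/
theorem eq_zero_of_tensor_square (hn : 2 ≤ n) {h : Matrix (Fin n) (Fin n) ℝ} (hd : h.det ≠ 0)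
    {v : Fin n → ℝ} {ν : ℝ} (H : ∀ a b, v a * v b = ν * h a b) : v = 0 := by
  have : Nontrivial (Fin n) := Fin.nontrivial_iff_two_le.2 hn
  have e : Matrix.vecMulVec v v = ν • h := by
    ext a b
    exact H a b
  -- A rank one matrix of size at least two is singular, so `ν ^ n * det h = 0` and `ν` must vanish.
  have h1 := Matrix.det_vecMulVec v v
  rw [e, Matrix.det_smul] at h1
  have h2 : ν = 0 := by
    rcases mul_eq_zero.1 h1 with h3 | h3
    · exact pow_eq_zero_iff (by simp; omega) |>.1 h3
    · exact absurd h3 hd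
  funext a
  have := H a a
  rw [h2, zero_mul] at this
  exact mul_self_eq_zero.1 this

/-- A quadratic polynomial vanishing identically has vanishing coefficients. -/
theorem quadratic_coeff_eq_zero {F₀ δ : ℝ} {l : Fin n → ℝ} {h : Fin n → Fin n → ℝ}
    (hh : ∀ i j, h i j = h j i)
    (H : ∀ p : Fin n → ℝ, F₀ + ∑ j, l j * p j + δ * ∑ i, ∑ j, h i j * (p i * p j) = 0) :
    F₀ = 0 ∧ (∀ j, l j = 0) ∧ ∀ i j, δ * h i j = 0 := by
  have h0 : F₀ = 0 := by simpa using H 0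
  -- Restricting to the plane spanned by two coordinate vectors suffices: its points with `s, t` in
  -- `{-1, 0, 1}` already separate the coefficients.
  have hs : ∀ (a b : Fin n) (s t : ℝ), s * l a + t * l b
      + δ * (s * s * h a a + s * t * h a b + t * s * h b a + t * t * h b b) = 0 := by
    intro a b s t
    have e := H (s • Pi.single a 1 + t • Pi.single b 1)
    have e1 : ∑ j, l j * (s • Pi.single a 1 + t • Pi.single b 1 : Fin n → ℝ) j
        = s * l a + t * l b := by
      simp [mul_add, Finset.sum_add_distrib, Pi.single_apply, mul_comm]
    have e2 : ∑ i, ∑ j, h i j * ((s • Pi.single a 1 + t • Pi.single b 1 : Fin n → ℝ) i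
          * (s • Pi.single a 1 + t • Pi.single b 1 : Fin n → ℝ) j)
        = s * s * h a a + s * t * h a b + t * s * h b a + t * t * h b b := by
      simp [mul_add, add_mul, Finset.sum_add_distrib, Pi.single_apply]
      ring
    rw [e1, e2, h0, zero_add] at e
    exact e
  have hl : ∀ j, l j = 0 := fun j => by
    have e1 := hs j j 1 0
    have e2 := hs j j (-1) 0
    linarith
  refine ⟨h0, hl, fun i j => ?_⟩
  have e1 := hs i j 1 1
  have e2 := hs i j 1 0
  have e3 := hs i j 0 1
  rw [hh j i] at e1 e2 e3
  linarith [hl i, hl j]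

end Algebra

/-! ### The dependence of the prolongation on second derivatives -/

section Symbol

variable {n : ℕ} {U : Set (Coord n)} {G : Coord n → Matrix (Fin n) (Fin n) ℝ}
  {V : Coord n → ℝ} {ξ : Jet0 n → Coord n} {η : Jet0 n → ℝ} {x : Coord n}

/-- The coefficient of `u_ab` in `X^[2] H`. -/
def symbolCoeff (G : Coord n → Matrix (Fin n) (Fin n) ℝ) (ξ : Jet0 n → Coord n) (η : Jet0 n → ℝ)
    (x : Coord n) (u : ℝ) (p : Fin n → ℝ) (a b : Fin n) : ℝ :=
  fderiv ℝ (fun y => (G y)⁻¹ a b) x (ξ (x, u))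
    + (G x)⁻¹ a b * (pdu η (x, u) - ∑ k, p k * pdu (fun z => ξ z k) (x, u))
    - 2 * ∑ l, (G x)⁻¹ a l * (pdx l (fun z => ξ z b) (x, u) + p l * pdu (fun z => ξ z b) (x, u))

/-- Symmetry of `h` and `q` makes the two contractions with `N` equal, whence the factor `2` in
`symbolCoeff`. The resulting coefficient need not be symmetric in its indices. -/
theorem symbol_index_identity (h q d N : Fin n → Fin n → ℝ) (hh : ∀ i j, h i j = h j i)
    (hq : ∀ i j, q i j = q j i) (e : ℝ) (w : ℝ) :
    ∑ i, ∑ j, (h i j * (q j i * e - q j i * w - ∑ k, q j k * N i k - ∑ k, q i k * N j k)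
        + d i j * q i j)
      = ∑ i, ∑ j, (d i j + h i j * (e - w) - 2 * ∑ l, h i l * N l j) * q i j := by
  have e1 : ∑ i, ∑ j, h i j * ∑ k, q i k * N j k = ∑ i, ∑ j, (∑ l, h i l * N l j) * q i j := by
    refine Finset.sum_congr rfl fun i _ => ?_
    simp only [Finset.mul_sum, Finset.sum_mul]
    rw [Finset.sum_comm]
    exact Finset.sum_congr rfl fun j _ => Finset.sum_congr rfl fun k _ => by ring
  have e2 : ∑ i, ∑ j, h i j * ∑ k, q j k * N i k = ∑ i, ∑ j, h i j * ∑ k, q i k * N j k := by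
    rw [Finset.sum_comm]
    exact Finset.sum_congr rfl fun i _ => Finset.sum_congr rfl fun j _ => by rw [hh]
  have e3 : ∑ i, ∑ j, 2 * (∑ l, h i l * N l j) * q i j
      = 2 * ∑ i, ∑ j, (∑ l, h i l * N l j) * q i j := by
    simp only [mul_assoc, ← Finset.mul_sum]
  have e4 : ∑ i, ∑ j, h i j * (q j i * e) = ∑ i, ∑ j, h i j * e * q i j :=
    Finset.sum_congr rfl fun i _ => Finset.sum_congr rfl fun j _ => by rw [hq j i]; ring
  have e5 : ∑ i, ∑ j, h i j * (q j i * w) = ∑ i, ∑ j, h i j * w * q i j :=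
    Finset.sum_congr rfl fun i _ => Finset.sum_congr rfl fun j _ => by rw [hq j i]; ring
  simp only [mul_sub, sub_mul, add_mul, Finset.sum_add_distrib, Finset.sum_sub_distrib, e1, e2,
    e3, e4, e5]
  ring

theorem prolongApply_eq (hG : IsMetricOn G U) (hV : ContDiffOn ℝ ∞ V U) (J : Jet2 n)
    (hJ : J.1 ∈ U) :
    prolongApply ξ η (kgFun G V) J
      = (∑ i, ∑ j, ((G J.1)⁻¹ i j * eta2 ξ η i j J
          + fderiv ℝ (fun y => (G y)⁻¹ i j) J.1 (ξ (J.1, J.2.1)) * J.2.2.2 i j))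
        + (∑ j, (drift G j J.1 * eta1 ξ η j (J.1, J.2.1, J.2.2.1)
          + fderiv ℝ (drift G j) J.1 (ξ (J.1, J.2.1)) * J.2.2.1 j))
        - (V J.1 * η (J.1, J.2.1) + fderiv ℝ V J.1 (ξ (J.1, J.2.1)) * J.2.1) :=
  fderiv_kgFun hG hV J _ hJ

/-- `X^[2] H` is an affine function of the second derivatives. -/
theorem prolongApply_affine (hG : IsMetricOn G U) (hV : ContDiffOn ℝ ∞ V U)
    (hξ : ∀ k, ContDiffOn ℝ ∞ (fun z => ξ z k) (U ×ˢ Set.univ))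
    (hη : ContDiffOn ℝ ∞ η (U ×ˢ Set.univ)) (hx : x ∈ U) (u : ℝ) (p : Fin n → ℝ)
    {q : Fin n → Fin n → ℝ} (hq : ∀ i j, q i j = q j i) :
    prolongApply ξ η (kgFun G V) (x, u, p, q)
      = prolongApply ξ η (kgFun G V) (x, u, p, 0)
        + ∑ a, ∑ b, symbolCoeff G ξ η x u p a b * q a b := by
  rw [prolongApply_eq hG hV _ hx, prolongApply_eq hG hV _ hx]
  -- The coefficients `η_[ij]` contain no products of second derivatives, so their change from `q =
  -- 0` is linear in `q`.
  have key : ∀ i j, eta2 ξ η i j (x, u, p, q) = eta2 ξ η i j (x, u, p, 0)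
      + (q j i * pdu η (x, u) - q j i * (∑ k, p k * pdu (fun z => ξ z k) (x, u))
        - ∑ k, q j k * (pdx i (fun z => ξ z k) (x, u) + p i * pdu (fun z => ξ z k) (x, u))
        - ∑ k, q i k * (pdx j (fun z => ξ z k) (x, u) + p j * pdu (fun z => ξ z k) (x, u))) := by
    intro i j
    rw [eta2_eq hG.isOpen hξ hη i j x hx, eta2_eq hG.isOpen hξ hη i j x hx]
    have e1 : ∑ k, p k * (q j i * pdu (fun z => ξ z k) (x, u))
        = q j i * ∑ k, p k * pdu (fun z => ξ z k) (x, u) := by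
      rw [Finset.mul_sum]
      exact Finset.sum_congr rfl fun k _ => by ring
    simp only [Pi.zero_apply, zero_mul, add_zero, Finset.sum_const_zero, mul_add,
      Finset.sum_add_distrib, e1, totalDeriv0_eq _ (fun z => ξ z _)]
    ring
  have e := symbol_index_identity (fun i j => (G x)⁻¹ i j) q
    (fun i j => fderiv ℝ (fun y => (G y)⁻¹ i j) x (ξ (x, u)))
    (fun i k => pdx i (fun z => ξ z k) (x, u) + p i * pdu (fun z => ξ z k) (x, u))
    (hG.inv_symm hx) hq (pdu η (x, u)) (∑ k, p k * pdu (fun z => ξ z k) (x, u))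
  simp only [symbolCoeff]
  rw [← e]
  simp only [key, mul_add, Finset.sum_add_distrib, Pi.zero_apply, mul_zero, Finset.sum_const_zero]
  ring

end Symbol

/-! ## Fibre preserving generators -/

section Reduced

variable {n : ℕ} {U : Set (Coord n)} {G : Coord n → Matrix (Fin n) (Fin n) ℝ}
  {V : Coord n → ℝ} {ξ : Jet0 n → Coord n} {η : Jet0 n → ℝ} {x : Coord n} {ζ : Coord n → Coord n}

theorem hasDerivAt_fibre {F : Jet0 n → ℝ} {u : ℝ} (hF : DifferentiableAt ℝ F (x, u)) :
    HasDerivAt (fun t => F (x, t)) (pdu F (x, u)) u :=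
  hF.hasFDerivAt.comp_hasDerivAt (f := fun t => (x, t)) u
    ((hasDerivAt_const u x).prodMk (hasDerivAt_id u))

theorem pdx_eq_pd {F : Jet0 n → ℝ} {u : ℝ} (hF : DifferentiableAt ℝ F (x, u)) (i : Fin n) :
    pdx i F (x, u) = pd i (fun y => F (y, u)) x := by
  have h : HasFDerivAt (fun y => F (y, u)) ((fderiv ℝ F (x, u)).comp
      ((ContinuousLinearMap.id ℝ (Coord n)).prod 0)) x :=
    HasFDerivAt.comp (f := fun y : Coord n => (y, u)) x hF.hasFDerivAt
      ((hasFDerivAt_id x).prodMk (hasFDerivAt_const u x))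
  rw [pd, h.fderiv]
  rfl

theorem pdx_of_affine {F : Jet0 n → ℝ} {f f' : Coord n → ℝ} (hU : IsOpen U)
    (hF : ContDiffOn ℝ ∞ F (U ×ˢ Set.univ)) (hf : ContDiffOn ℝ ∞ f U) (hf' : ContDiffOn ℝ ∞ f' U)
    (h : ∀ y ∈ U, ∀ u, F (y, u) = f y * u + f' y) (hx : x ∈ U) (u : ℝ) (i : Fin n) :
    pdx i F (x, u) = pd i f x * u + pd i f' x := by
  have hd := differentiableAt_of_contDiffOn hU hf hx
  rw [pdx_eq_pd (differentiableAt_of_cylinder hU hF hx), pd_congr hU (fun y hy => h y hy u) hx,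
    pd_add (hd.mul_const u) (differentiableAt_of_contDiffOn hU hf' hx), pd,
    fderiv_mul_const hd]
  simp [pd, mul_comm]

theorem pdu_of_affine {F : Jet0 n → ℝ} {f f' : Coord n → ℝ} (hU : IsOpen U)
    (hF : ContDiffOn ℝ ∞ F (U ×ˢ Set.univ)) (h : ∀ y ∈ U, ∀ u, F (y, u) = f y * u + f' y)
    (hx : x ∈ U) (u : ℝ) : pdu F (x, u) = f x := by
  have e : (fun t => F (x, t)) = fun t => f x * t + f' x := funext fun t => h x hx t
  have h1 := hasDerivAt_fibre (differentiableAt_of_cylinder hU hF (z := (x, u)) hx)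
  rw [e] at h1
  have h2 : HasDerivAt (fun t => f x * t + f' x) (f x) u := by
    simpa using ((hasDerivAt_id u).const_mul (f x)).add_const (f' x)
  exact h1.unique h2

theorem pdx_of_base {F : Jet0 n → ℝ} {f : Coord n → ℝ} (hU : IsOpen U)
    (hF : ContDiffOn ℝ ∞ F (U ×ˢ Set.univ)) (h : ∀ y ∈ U, ∀ u, F (y, u) = f y)
    (hx : x ∈ U) (u : ℝ) (i : Fin n) : pdx i F (x, u) = pd i f x := by
  rw [pdx_eq_pd (differentiableAt_of_cylinder hU hF hx), pd_congr hU (fun y hy => h y hy u) hx]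

theorem pdu_of_base {F : Jet0 n → ℝ} {f : Coord n → ℝ} (hU : IsOpen U)
    (hF : ContDiffOn ℝ ∞ F (U ×ˢ Set.univ)) (h : ∀ y ∈ U, ∀ u, F (y, u) = f y)
    (hx : x ∈ U) (u : ℝ) : pdu F (x, u) = 0 :=
  pdu_of_affine (f := fun _ => 0) (f' := f) hU hF (fun y hy t => by simp [h y hy t]) hx u

theorem symbolCoeff_reduced (hU : IsOpen U)
    (hξ : ∀ k, ContDiffOn ℝ ∞ (fun z => ξ z k) (U ×ˢ Set.univ))
    (hζ : ∀ y ∈ U, ∀ u, ξ (y, u) = ζ y) (hx : x ∈ U) (u : ℝ) (p : Fin n → ℝ) (a b : Fin n) :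
    symbolCoeff G ξ η x u p a b = fderiv ℝ (fun y => (G y)⁻¹ a b) x (ζ x)
      + (G x)⁻¹ a b * pdu η (x, u) - 2 * ∑ l, (G x)⁻¹ a l * pd l (fun y => ζ y b) x := by
  have h1 : ∀ k, pdu (fun z => ξ z k) (x, u) = 0 := fun k =>
    pdu_of_base (f := fun y => ζ y k) hU (hξ k) (fun y hy t => by rw [hζ y hy t]) hx u
  have h2 : ∀ l k, pdx l (fun z => ξ z k) (x, u) = pd l (fun y => ζ y k) x := fun l k =>
    pdx_of_base hU (hξ k) (fun y hy t => by rw [hζ y hy t]) hx u l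
  simp only [symbolCoeff, h1, h2, hζ x hx u]
  simp

/-- Once `ξ` is independent of `u`, the momenta drop out of the symbol, and the two orders of the
Jacobian term are exactly those of the Lie derivative of the inverse metric. -/
theorem symbolCoeff_symmetrized (hG : IsMetricOn G U)
    (hξ : ∀ k, ContDiffOn ℝ ∞ (fun z => ξ z k) (U ×ˢ Set.univ))
    (hζ : ∀ y ∈ U, ∀ u, ξ (y, u) = ζ y) (hx : x ∈ U) (u : ℝ) (p : Fin n → ℝ) (a b : Fin n) :
    symbolCoeff G ξ η x u p a b + symbolCoeff G ξ η x u p b a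
      = 2 * (lieInv G ζ x a b + (G x)⁻¹ a b * pdu η (x, u)) := by
  rw [symbolCoeff_reduced hG.isOpen hξ hζ hx, symbolCoeff_reduced hG.isOpen hξ hζ hx]
  simp only [lieInv, Matrix.sub_apply, matDeriv, Matrix.of_apply, Matrix.mul_apply, jac,
    Matrix.transpose_apply]
  rw [hG.inv_symm hx b a, fderiv_congr_on hG.isOpen (fun y hy => hG.inv_symm hy b a) hx]
  have : ∑ l, pd l (fun y => ζ y a) x * (G x)⁻¹ l b
      = ∑ l, (G x)⁻¹ b l * pd l (fun y => ζ y a) x :=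
    Finset.sum_congr rfl fun l _ => by rw [hG.inv_symm hx l b, mul_comm]
  rw [this]
  ring

/-- Sorting by degree in `p`. The derivatives of `ξ` with respect to `u` are already absent, so
there is no cubic term and the quadratic one has the single coefficient `δ`, later `η_uu`. -/
theorem lower_order_index_identity (h α : Fin n → Fin n → ℝ) (β γ B ε d : Fin n → ℝ)
    (c : Fin n → Fin n → Fin n → ℝ) (m : Fin n → Fin n → ℝ) (δ θ e : ℝ) (p : Fin n → ℝ) :
    (∑ i, ∑ j, h i j * (α i j + p j * β i + p i * (γ j + p j * δ) - ∑ k, p k * c i j k))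
      + (∑ j, (B j * (ε j + p j * θ - ∑ k, p k * m j k) + d j * p j)) - e
      = (∑ i, ∑ j, h i j * α i j + ∑ j, B j * ε j - e)
        + ∑ j, (∑ i, h i j * β i + ∑ i, h j i * γ i - ∑ i, ∑ k, h i k * c i k j
          + B j * θ - ∑ k, B k * m k j + d j) * p j
        + δ * ∑ i, ∑ j, h i j * (p i * p j) := by
  have e1 : ∑ i, ∑ j, h i j * (p j * β i) = ∑ j, (∑ i, h i j * β i) * p j := by
    rw [Finset.sum_comm]
    simp only [Finset.sum_mul]
    exact Finset.sum_congr rfl fun i _ => Finset.sum_congr rfl fun j _ => by ring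
  have e2 : ∑ i, ∑ j, h i j * (p i * γ j) = ∑ j, (∑ i, h j i * γ i) * p j := by
    simp only [Finset.sum_mul]
    exact Finset.sum_congr rfl fun i _ => Finset.sum_congr rfl fun j _ => by ring
  have e3 : ∑ i, ∑ j, h i j * (p i * (p j * δ)) = δ * ∑ i, ∑ j, h i j * (p i * p j) := by
    simp only [Finset.mul_sum]
    exact Finset.sum_congr rfl fun i _ => Finset.sum_congr rfl fun j _ => by ring
  have e4 : ∑ i, ∑ j, h i j * ∑ k, p k * c i j k
      = ∑ j, (∑ i, ∑ k, h i k * c i k j) * p j := by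
    simp only [Finset.sum_mul, Finset.mul_sum]
    rw [Finset.sum_comm' (t' := Finset.univ) (s' := fun _ => Finset.univ) (by simp)]
    rw [Finset.sum_comm]
    conv_rhs => rw [Finset.sum_comm]
    refine Finset.sum_congr rfl fun i _ => ?_
    rw [Finset.sum_comm]
    exact Finset.sum_congr rfl fun j _ => Finset.sum_congr rfl fun k _ => by ring
  have e5 : ∑ j, B j * ∑ k, p k * m j k = ∑ j, (∑ k, B k * m k j) * p j := by
    simp only [Finset.sum_mul, Finset.mul_sum]
    rw [Finset.sum_comm]
    exact Finset.sum_congr rfl fun i _ => Finset.sum_congr rfl fun j _ => by ring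
  have e6 : ∑ j, B j * (p j * θ) = ∑ j, B j * θ * p j :=
    Finset.sum_congr rfl fun j _ => by ring
  simp only [mul_add, mul_sub, add_mul, sub_mul, Finset.sum_add_distrib, Finset.sum_sub_distrib,
    e1, e2, e3, e4, e5, e6]
  ring

/-- `X^[2] H` at vanishing second derivatives is a quadratic polynomial in the first
derivatives if `X` is fibre preserving. -/
theorem prolongApply_lower_order (hG : IsMetricOn G U) (hV : ContDiffOn ℝ ∞ V U)
    (hξ : ∀ k, ContDiffOn ℝ ∞ (fun z => ξ z k) (U ×ˢ Set.univ))
    (hη : ContDiffOn ℝ ∞ η (U ×ˢ Set.univ))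
    (hζ : ∀ y ∈ U, ∀ u, ξ (y, u) = ζ y) (hx : x ∈ U) (u : ℝ) (p : Fin n → ℝ) :
    prolongApply ξ η (kgFun G V) (x, u, p, 0)
      = (∑ i, ∑ j, (G x)⁻¹ i j * pdx j (pdx i η) (x, u) + ∑ j, drift G j x * pdx j η (x, u)
          - (V x * η (x, u) + fderiv ℝ V x (ζ x) * u))
        + ∑ j, (∑ i, (G x)⁻¹ i j * pdu (pdx i η) (x, u) + ∑ i, (G x)⁻¹ j i * pdx i (pdu η) (x, u)
            - ∑ i, ∑ k, (G x)⁻¹ i k * pd k (pd i fun y => ζ y j) x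
            + drift G j x * pdu η (x, u) - ∑ k, drift G k x * pd k (fun y => ζ y j) x
            + fderiv ℝ (drift G j) x (ζ x)) * p j
        + pdu (pdu η) (x, u) * ∑ i, ∑ j, (G x)⁻¹ i j * (p i * p j) := by
  have hU := hG.isOpen
  have hζ' : ∀ k, ∀ y ∈ U, ∀ t, (fun z => ξ z k) (y, t) = (fun y => ζ y k) y :=
    fun k y hy t => by simp only [hζ y hy t]
  have h1 : ∀ k, ∀ y ∈ U, ∀ t, pdu (fun z => ξ z k) (y, t) = 0 := fun k y hy t =>
    pdu_of_base hU (hξ k) (hζ' k) hy t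
  have h2 : ∀ l k, ∀ y ∈ U, ∀ t, pdx l (fun z => ξ z k) (y, t) = pd l (fun y => ζ y k) y :=
    fun l k y hy t => pdx_of_base hU (hξ k) (hζ' k) hy t l
  have h3 : ∀ j k, totalDeriv0 j (pdu fun z => ξ z k) (x, u, p) = 0 := fun j k => by
    have c := contDiffOn_pdu hU (hξ k)
    rw [totalDeriv0_eq, pdx_of_base (f := fun _ => 0) hU c (h1 k) hx,
      pdu_of_base (f := fun _ => 0) hU c (h1 k) hx]
    simp [pd]
  have h4 : ∀ j i k, totalDeriv0 j (pdx i fun z => ξ z k) (x, u, p)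
      = pd j (pd i fun y => ζ y k) x := fun j i k => by
    have c := contDiffOn_pdx hU (hξ k) i
    rw [totalDeriv0_eq, pdx_of_base hU c (h2 i k) hx, pdu_of_base hU c (h2 i k) hx]
    simp
  rw [prolongApply_eq hG hV _ hx]
  rw [← lower_order_index_identity (fun i j => (G x)⁻¹ i j) (fun i j => pdx j (pdx i η) (x, u))
    (fun i => pdu (pdx i η) (x, u)) (fun i => pdx i (pdu η) (x, u)) (fun j => drift G j x)
    (fun j => pdx j η (x, u)) (fun j => fderiv ℝ (drift G j) x (ζ x))
    (fun i k j => pd k (pd i fun y => ζ y j) x) (fun k j => pd k (fun y => ζ y j) x)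
    (pdu (pdu η) (x, u)) (pdu η (x, u)) _ p]
  simp only [eta2_eq hU hξ hη _ _ x hx, eta1_eq, h1 _ x hx, h2 _ _ x hx, h3, h4, hζ x hx,
    totalDeriv0_eq _ (pdx _ η), totalDeriv0_eq _ (pdu η)]
  simp

/-- The Laplace operator in nondivergence form. -/
theorem IsMetricOn.laplacian_eq (hG : IsMetricOn G U) {f : Coord n → ℝ}
    (hf : ContDiffOn ℝ ∞ f U) (hx : x ∈ U) :
    laplacian G f x = ∑ i, ∑ j, (G x)⁻¹ i j * pd i (pd j f) x + ∑ j, drift G j x * pd j f x := by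
  -- With zero potential, evaluating the equation on the 2-jet of `f` gives its Laplacian.
  have h := kgFun_jet G (fun _ => 0) f x (hG.det_ne_zero x hx)
    (fun i j => differentiableAt_of_contDiffOn hG.isOpen (hG.contDiffOn_sqrtDet.mul (hG.inv i j))
      hx)
    (fun j => differentiableAt_of_contDiffOn hG.isOpen (contDiffOn_pd hG.isOpen hf j) hx)
  rw [kgFun_eq] at h
  simpa using h.symm

end Reduced

/-! ## Symmetries in a coordinate domain -/

section Local

variable {n : ℕ} {U : Set (Coord n)} {G : Coord n → Matrix (Fin n) (Fin n) ℝ}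
  {V : Coord n → ℝ} {ξ : Jet0 n → Coord n} {η : Jet0 n → ℝ} {x : Coord n} {ζ : Coord n → Coord n}

/-- The derivative of the Klein–Gordon equation along the second prolongation vanishes on the
equation. -/
def VanishesOnShell (G : Coord n → Matrix (Fin n) (Fin n) ℝ) (V : Coord n → ℝ) (U : Set (Coord n))
    (ξ : Jet0 n → Coord n) (η : Jet0 n → ℝ) : Prop :=
  ∀ J : Jet2 n, J.1 ∈ U → (∀ i j, J.2.2.2 i j = J.2.2.2 j i) → kgFun G V J = 0 →
    prolongApply ξ η (kgFun G V) J = 0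

/-- The multiplier of a symmetry of the Klein–Gordon equation. -/
def multiplier (G : Coord n → Matrix (Fin n) (Fin n) ℝ) (ξ : Jet0 n → Coord n) (η : Jet0 n → ℝ)
    (x : Coord n) (u : ℝ) (p : Fin n → ℝ) : ℝ :=
  (n : ℝ)⁻¹ * ∑ i, ∑ j, symbolCoeff G ξ η x u p i j * G x i j

/-- At fixed `(x, u, p)` the equation is the hyperplane `g⁻¹ : q = V u - B · p`, on which the affine
function `X^[2] H` of `q` vanishes. `symmetrized_eq_of_vanish` identifies the proportionality factor
as `multiplier`. -/
theorem VanishesOnShell.symbol_eq (hS : VanishesOnShell G V U ξ η) (hn : n ≠ 0)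
    (hG : IsMetricOn G U) (hV : ContDiffOn ℝ ∞ V U)
    (hξ : ∀ k, ContDiffOn ℝ ∞ (fun z => ξ z k) (U ×ˢ Set.univ))
    (hη : ContDiffOn ℝ ∞ η (U ×ˢ Set.univ)) (hx : x ∈ U) (u : ℝ) (p : Fin n → ℝ) :
    (∀ a b, symbolCoeff G ξ η x u p a b + symbolCoeff G ξ η x u p b a
        = 2 * multiplier G ξ η x u p * (G x)⁻¹ a b) ∧
      prolongApply ξ η (kgFun G V) (x, u, p, 0)
        + multiplier G ξ η x u p * (V x * u - ∑ j, drift G j x * p j) = 0 := by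
  refine symmetrized_eq_of_vanish hn (h := (G x)⁻¹) (g := G x) ?_ (hG.symm x hx) (hG.inv_mul hx)
    fun q hq hc => ?_
  · ext i j
    exact hG.inv_symm hx j i
  · rw [← prolongApply_affine hG hV hξ hη hx u p hq]
    refine hS _ hx hq ?_
    rw [kgFun_eq]
    simp only
    rw [hc]
    ring

/-- The components `ξⁱ` of a symmetry do not depend on `u`. -/
theorem VanishesOnShell.pdu_eq_zero (hS : VanishesOnShell G V U ξ η) (hn : 2 ≤ n)
    (hG : IsMetricOn G U) (hV : ContDiffOn ℝ ∞ V U)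
    (hξ : ∀ k, ContDiffOn ℝ ∞ (fun z => ξ z k) (U ×ˢ Set.univ))
    (hη : ContDiffOn ℝ ∞ η (U ×ˢ Set.univ)) (hx : x ∈ U) (u : ℝ) (k : Fin n) :
    pdu (fun z => ξ z k) (x, u) = 0 := by
  set v : Fin n → ℝ := fun k => pdu (fun z => ξ z k) (x, u) with hv
  -- The momentum is `v` with its index lowered, so that raising it again produces the square `v ⊗
  -- v` in the symbol.
  set p : Fin n → ℝ := fun l => ∑ m, G x l m * v m with hp
  have hw : ∀ a, ∑ l, (G x)⁻¹ a l * p l = v a := by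
    intro a
    have e : (G x)⁻¹.mulVec ((G x).mulVec v) = v := by
      rw [Matrix.mulVec_mulVec, hG.inv_mul hx, Matrix.one_mulVec]
    exact congrFun e a
  have e0 := (hS.symbol_eq (by omega) hG hV hξ hη hx u 0).1
  have e1 := (hS.symbol_eq (by omega) hG hV hξ hη hx u p).1
  have hdet : ((G x)⁻¹).det ≠ 0 := by
    rw [Matrix.det_nonsing_inv, Ring.inverse_eq_inv']
    exact inv_ne_zero (hG.det_ne_zero x hx)
  have hs : ∀ a b, ∑ l, (G x)⁻¹ a l * (pdx l (fun z => ξ z b) (x, u) + p l * v b)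
      = ∑ l, (G x)⁻¹ a l * pdx l (fun z => ξ z b) (x, u) + v a * v b := by
    intro a b
    rw [← hw a, Finset.sum_mul, ← Finset.sum_add_distrib]
    exact Finset.sum_congr rfl fun l _ => by ring
  -- Subtracting the symbol equations at momenta `p` and `0` removes everything but `v ⊗ v` and
  -- multiples of `g⁻¹`; `ν` collects the latter.
  have key := eq_zero_of_tensor_square (v := v) (ν := (multiplier G ξ η x u 0
    - multiplier G ξ η x u p - ∑ k, p k * v k) / 2) hn hdet fun a b => by
    have f0 := e0 a b
    have f1 := e1 a b
    have hkk : ∀ k, pdu (fun z => ξ z k) (x, u) = v k := fun k => rfl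
    simp only [symbolCoeff, hkk, hs, Pi.zero_apply, zero_mul, Finset.sum_const_zero, add_zero,
      sub_zero, hG.inv_symm hx b a] at f0 f1
    linarith
  exact congrFun key k

/-- The fibre is the whole line `ℝ`, so a vanishing `u`-derivative gives constancy along it; `u = 0`
serves as base point. -/
theorem VanishesOnShell.eq_base (hS : VanishesOnShell G V U ξ η) (hn : 2 ≤ n)
    (hG : IsMetricOn G U) (hV : ContDiffOn ℝ ∞ V U)
    (hξ : ∀ k, ContDiffOn ℝ ∞ (fun z => ξ z k) (U ×ˢ Set.univ))
    (hη : ContDiffOn ℝ ∞ η (U ×ˢ Set.univ)) (hx : x ∈ U) (u : ℝ) : ξ (x, u) = ξ (x, 0) := by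
  ext k
  have h : ∀ t, HasDerivAt (fun t => ξ (x, t) k) 0 t := fun t => by
    rw [← hS.pdu_eq_zero hn hG hV hξ hη hx t k]
    exact hasDerivAt_fibre (F := fun z => ξ z k)
      (differentiableAt_of_cylinder hG.isOpen (hξ k) (z := (x, t)) hx)
  exact is_const_of_deriv_eq_zero (fun t => (h t).differentiableAt) (fun t => (h t).deriv) u 0

theorem contDiffOn_slice {F : Jet0 n → ℝ} (hF : ContDiffOn ℝ ∞ F (U ×ˢ Set.univ)) (u : ℝ) :
    ContDiffOn ℝ ∞ (fun y => F (y, u)) U :=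
  hF.comp (contDiff_id.prodMk contDiff_const).contDiffOn fun _ hy => ⟨hy, trivial⟩

theorem IsMetricOn.sum_inv_mul_eq_zero (hG : IsMetricOn G U) (hx : x ∈ U) {w : Fin n → ℝ}
    (h : ∀ j, ∑ i, (G x)⁻¹ i j * w i = 0) (i : Fin n) : w i = 0 := by
  have e : (G x)⁻¹.mulVec w = 0 := by
    funext j
    refine Eq.trans (b := ∑ i, (G x)⁻¹ j i * w i) rfl (Eq.trans ?_ (h j))
    exact Finset.sum_congr rfl fun i _ => by rw [hG.inv_symm hx j i]
  have e' : (G x).mulVec ((G x)⁻¹.mulVec w) = w := by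
    rw [Matrix.mulVec_mulVec, hG.mul_inv hx, Matrix.one_mulVec]
  rw [← e', e, Matrix.mulVec_zero]
  rfl

/-- Needed to cancel `g^{ij}` from `η_uu g^{ij} = 0`. Individual entries, even diagonal ones, may
vanish in indefinite signature. -/
theorem IsMetricOn.exists_inv_ne_zero (hG : IsMetricOn G U) (hx : x ∈ U) (hn : n ≠ 0) :
    ∃ i j, (G x)⁻¹ i j ≠ 0 := by
  by_contra! h
  have : (G x)⁻¹ = 0 := by ext i j; exact h i j
  have e := hG.inv_mul hx
  rw [this, Matrix.zero_mul] at e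
  have i : Fin n := ⟨0, Nat.pos_of_ne_zero hn⟩
  have e' := congrFun (congrFun e i) i
  rw [Matrix.one_apply_eq, Matrix.zero_apply] at e'
  exact zero_ne_one e'

/-- The first half of the determining equations of a symmetry. -/
theorem VanishesOnShell.conformal (hS : VanishesOnShell G V U ξ η) (hn : n ≠ 0)
    (hG : IsMetricOn G U) (hV : ContDiffOn ℝ ∞ V U)
    (hξ : ∀ k, ContDiffOn ℝ ∞ (fun z => ξ z k) (U ×ˢ Set.univ))
    (hη : ContDiffOn ℝ ∞ η (U ×ˢ Set.univ)) (hζ : ∀ y ∈ U, ∀ u, ξ (y, u) = ζ y)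
    (hx : x ∈ U) (u : ℝ) (p : Fin n → ℝ) :
    (∀ i j, lieMetric G ζ i j x = 2 * confFactor G ζ x * G x i j) ∧
      multiplier G ξ η x u p = pdu η (x, u) - 2 * confFactor G ζ x := by
  set μ := multiplier G ξ η x u p with hμ
  have e := (hS.symbol_eq hn hG hV hξ hη hx u p).1
  have h1 : lieInv G ζ x = -((pdu η (x, u) - μ) • (G x)⁻¹) := by
    ext a b
    have e1 := e a b
    rw [symbolCoeff_symmetrized hG hξ hζ hx] at e1
    simp only [Matrix.neg_apply, Matrix.smul_apply, smul_eq_mul]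
    linarith
  have h2 : ∀ i j, lieMetric G ζ i j x = 2 * ((pdu η (x, u) - μ) / 2) * G x i j := by
    intro i j
    rw [(hG.lieInv_eq_iff hx _).1 h1 i j]
    ring
  have h3 := hG.confFactor_eq hx hn h2
  rw [h3]
  exact ⟨h2, by ring⟩

/-- The remaining determining equations of a symmetry. -/
theorem VanishesOnShell.lower_order (hS : VanishesOnShell G V U ξ η) (hn : n ≠ 0)
    (hG : IsMetricOn G U) (hV : ContDiffOn ℝ ∞ V U)
    (hξ : ∀ k, ContDiffOn ℝ ∞ (fun z => ξ z k) (U ×ˢ Set.univ))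
    (hη : ContDiffOn ℝ ∞ η (U ×ˢ Set.univ)) (hζ : ∀ y ∈ U, ∀ u, ξ (y, u) = ζ y)
    (hx : x ∈ U) (u : ℝ) :
    (∑ i, ∑ j, (G x)⁻¹ i j * pdx j (pdx i η) (x, u) + ∑ j, drift G j x * pdx j η (x, u)
        - (V x * η (x, u) + fderiv ℝ V x (ζ x) * u)
        + (pdu η (x, u) - 2 * confFactor G ζ x) * (V x * u) = 0) ∧
      (∀ j, ∑ i, (G x)⁻¹ i j * pdu (pdx i η) (x, u) + ∑ i, (G x)⁻¹ j i * pdx i (pdu η) (x, u)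
            - ∑ i, ∑ k, (G x)⁻¹ i k * pd k (pd i fun y => ζ y j) x
            + drift G j x * pdu η (x, u) - ∑ k, drift G k x * pd k (fun y => ζ y j) x
            + fderiv ℝ (drift G j) x (ζ x)
            - (pdu η (x, u) - 2 * confFactor G ζ x) * drift G j x = 0) ∧
      pdu (pdu η) (x, u) = 0 := by
  -- Absorbs the multiplier terms into the constant and linear coefficients, which puts the identity
  -- in the form of a single polynomial in `p`.
  have aux : ∀ (X Q c r : ℝ) (L B p : Fin n → ℝ), (X + c * r) + ∑ j, (L j - c * B j) * p j + Q
      = X + ∑ j, L j * p j + Q + c * (r - ∑ j, B j * p j) := by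
    intro X Q c r L B p
    have : ∑ j, c * B j * p j = c * ∑ j, B j * p j := by
      rw [Finset.mul_sum]
      exact Finset.sum_congr rfl fun j _ => by ring
    simp only [sub_mul, Finset.sum_sub_distrib, this]
    ring
  have key := quadratic_coeff_eq_zero (hG.inv_symm hx) (fun p => by
    have e := (hS.symbol_eq hn hG hV hξ hη hx u p).2
    rw [(hS.conformal hn hG hV hξ hη hζ hx u p).2,
      prolongApply_lower_order hG hV hξ hη hζ hx u p] at e
    rw [← e]
    show (∑ i, ∑ j, (G x)⁻¹ i j * pdx j (pdx i η) (x, u) + ∑ j, drift G j x * pdx j η (x, u)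
        - (V x * η (x, u) + fderiv ℝ V x (ζ x) * u)
        + (pdu η (x, u) - 2 * confFactor G ζ x) * (V x * u))
      + ∑ j, (∑ i, (G x)⁻¹ i j * pdu (pdx i η) (x, u) + ∑ i, (G x)⁻¹ j i * pdx i (pdu η) (x, u)
            - ∑ i, ∑ k, (G x)⁻¹ i k * pd k (pd i fun y => ζ y j) x
            + drift G j x * pdu η (x, u) - ∑ k, drift G k x * pd k (fun y => ζ y j) x
            + fderiv ℝ (drift G j) x (ζ x)
            - (pdu η (x, u) - 2 * confFactor G ζ x) * drift G j x) * p j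
      + pdu (pdu η) (x, u) * ∑ i, ∑ j, (G x)⁻¹ i j * (p i * p j) = _
    exact aux _ _ _ _ _ _ p)
  refine ⟨key.1, key.2.1, ?_⟩
  obtain ⟨i, j, hij⟩ := hG.exists_inv_ne_zero hx hn
  exact (mul_eq_zero.1 (key.2.2 i j)).resolve_right hij

/-- A function whose second derivative along the fibres vanishes is affine in `u`. -/
theorem affine_of_pdu_pdu_eq_zero (hU : IsOpen U) (hη : ContDiffOn ℝ ∞ η (U ×ˢ Set.univ))
    (h : ∀ u, pdu (pdu η) (x, u) = 0) (hx : x ∈ U) (u : ℝ) :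
    η (x, u) = (η (x, 1) - η (x, 0)) * u + η (x, 0) := by
  have h1 : ∀ t, HasDerivAt (fun t => pdu η (x, t)) 0 t := fun t => by
    rw [← h t]
    exact hasDerivAt_fibre (differentiableAt_of_cylinder hU (contDiffOn_pdu hU hη) (z := (x, t)) hx)
  have h2 : ∀ t, pdu η (x, t) = pdu η (x, 0) := fun t =>
    is_const_of_deriv_eq_zero (fun t => (h1 t).differentiableAt) (fun t => (h1 t).deriv) t 0
  have h3 : ∀ t, HasDerivAt (fun t => η (x, t) - pdu η (x, 0) * t) 0 t := fun t => by
    have e := (hasDerivAt_fibre (differentiableAt_of_cylinder hU hη (z := (x, t)) hx)).fun_sub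
      ((hasDerivAt_id t).const_mul (pdu η (x, 0)))
    rw [h2 t] at e
    simpa only [id, mul_one, sub_self] using e
  have h4 : ∀ t, η (x, t) - pdu η (x, 0) * t = η (x, 0) - pdu η (x, 0) * 0 := fun t =>
    is_const_of_deriv_eq_zero (fun t => (h3 t).differentiableAt) (fun t => (h3 t).deriv) t 0
  have h5 := h4 1
  have h6 := h4 u
  have h7 : pdu η (x, 0) = η (x, 1) - η (x, 0) := by linarith
  rw [h7] at h6
  linarith

end Local

/-! ### Determining equations in a coordinate domain: necessity and sufficiency -/

section LocalTheorem

variable {n : ℕ} {U : Set (Coord n)} {G : Coord n → Matrix (Fin n) (Fin n) ℝ}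
  {V : Coord n → ℝ} {ξ : Jet0 n → Coord n} {η : Jet0 n → ℝ} {x : Coord n} {ζ : Coord n → Coord n}
  {a b ψ : Coord n → ℝ}

theorem IsMetricOn.sum_inv_pd_comm (hG : IsMetricOn G U) (hx : x ∈ U) {f : Coord n → ℝ} :
    ∑ i, ∑ j, (G x)⁻¹ i j * pd j (pd i f) x = ∑ i, ∑ j, (G x)⁻¹ i j * pd i (pd j f) x := by
  rw [Finset.sum_comm]
  exact Finset.sum_congr rfl fun i _ => Finset.sum_congr rfl fun j _ => by rw [hG.inv_symm hx]

theorem sum_affine_second_order (h α α' : Fin n → Fin n → ℝ) (d β β' : Fin n → ℝ) (u : ℝ) :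
    ∑ i, ∑ j, h i j * (α i j * u + α' i j) + ∑ j, d j * (β j * u + β' j)
      = (∑ i, ∑ j, h i j * α i j + ∑ j, d j * β j) * u
        + (∑ i, ∑ j, h i j * α' i j + ∑ j, d j * β' j) := by
  simp only [mul_add, Finset.sum_add_distrib, ← mul_assoc, ← Finset.sum_mul]
  ring

/-- For an affine `η`, the zeroth order part of the prolongation consists of two Laplacians. -/
theorem IsMetricOn.second_order_affine (hG : IsMetricOn G U)
    (hη : ContDiffOn ℝ ∞ η (U ×ˢ Set.univ)) (ha : ContDiffOn ℝ ∞ a U) (hb : ContDiffOn ℝ ∞ b U)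
    (hab : ∀ y ∈ U, ∀ u, η (y, u) = a y * u + b y) (hx : x ∈ U) (u : ℝ) :
    ∑ i, ∑ j, (G x)⁻¹ i j * pdx j (pdx i η) (x, u) + ∑ j, drift G j x * pdx j η (x, u)
      = laplacian G a x * u + laplacian G b x := by
  have hU := hG.isOpen
  have h1 : ∀ i, ∀ y ∈ U, ∀ t, pdx i η (y, t) = pd i a y * t + pd i b y := fun i y hy t =>
    pdx_of_affine hU hη ha hb hab hy t i
  have h2 : ∀ i j, pdx j (pdx i η) (x, u) = pd j (pd i a) x * u + pd j (pd i b) x := fun i j =>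
    pdx_of_affine hU (contDiffOn_pdx hU hη i) (contDiffOn_pd hU ha i) (contDiffOn_pd hU hb i)
      (h1 i) hx u j
  simp only [h2, h1 _ x hx]
  refine (sum_affine_second_order (fun i j => (G x)⁻¹ i j) (fun i j => pd j (pd i a) x)
    (fun i j => pd j (pd i b) x) (fun j => drift G j x) (fun j => pd j a x) (fun j => pd j b x)
    u).trans ?_
  rw [hG.sum_inv_pd_comm hx, hG.sum_inv_pd_comm hx,
    ← hG.laplacian_eq ha hx, ← hG.laplacian_eq hb hx]

/-- For an affine `η` and a conformal vector field, the first order part of the prolongation. -/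
theorem IsMetricOn.first_order_affine (hG : IsMetricOn G U)
    (hη : ContDiffOn ℝ ∞ η (U ×ˢ Set.univ)) (ha : ContDiffOn ℝ ∞ a U) (hb : ContDiffOn ℝ ∞ b U)
    (hab : ∀ y ∈ U, ∀ u, η (y, u) = a y * u + b y)
    (hζ : ∀ k, ContDiffOn ℝ ∞ (fun y => ζ y k) U) (hψ : ContDiffOn ℝ ∞ ψ U)
    (hC : ∀ y ∈ U, ∀ i j, lieMetric G ζ i j y = 2 * ψ y * G y i j) (hx : x ∈ U) (u : ℝ)
    (j : Fin n) :
    ∑ i, (G x)⁻¹ i j * pdu (pdx i η) (x, u) + ∑ i, (G x)⁻¹ j i * pdx i (pdu η) (x, u)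
          - ∑ i, ∑ k, (G x)⁻¹ i k * pd k (pd i fun y => ζ y j) x
          + drift G j x * pdu η (x, u) - ∑ k, drift G k x * pd k (fun y => ζ y j) x
          + fderiv ℝ (drift G j) x (ζ x)
      = (a x - 2 * ψ x) * drift G j x
        + ∑ i, (G x)⁻¹ i j * (2 * pd i a x - (2 - n) * pd i ψ x) := by
  have hU := hG.isOpen
  have h1 : ∀ i, ∀ y ∈ U, ∀ t, pdx i η (y, t) = pd i a y * t + pd i b y := fun i y hy t =>
    pdx_of_affine hU hη ha hb hab hy t i
  have h2 : ∀ i, pdu (pdx i η) (x, u) = pd i a x := fun i =>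
    pdu_of_affine hU (contDiffOn_pdx hU hη i) (h1 i) hx u
  have h3 : ∀ y ∈ U, ∀ t, pdu η (y, t) = a y := fun y hy t => pdu_of_affine hU hη hab hy t
  have h4 : ∀ i, pdx i (pdu η) (x, u) = pd i a x := fun i =>
    pdx_of_base hU (contDiffOn_pdu hU hη) h3 hx u i
  have e1 : ∑ i, (G x)⁻¹ j i * pd i a x = ∑ i, (G x)⁻¹ i j * pd i a x :=
    Finset.sum_congr rfl fun i _ => by rw [hG.inv_symm hx]
  have e2 : ∑ i, (G x)⁻¹ i j * (2 * pd i a x - (2 - n) * pd i ψ x)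
      = 2 * ∑ i, (G x)⁻¹ i j * pd i a x - (2 - n) * ∑ i, pd i ψ x * (G x)⁻¹ i j := by
    rw [Finset.mul_sum, Finset.mul_sum, ← Finset.sum_sub_distrib]
    exact Finset.sum_congr rfl fun i _ => by ring
  simp only [h2, h4, h3 x hx, e1, e2]
  rw [hG.sum_inv_pd_comm hx, hG.fderiv_drift_conformal hζ hψ hC hx j]
  ring

/-- The determining equations of the symmetries in a coordinate domain. -/
theorem VanishesOnShell.determining_equations (hS : VanishesOnShell G V U ξ η) (hn : 2 ≤ n)
    (hG : IsMetricOn G U) (hV : ContDiffOn ℝ ∞ V U)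
    (hξ : ∀ k, ContDiffOn ℝ ∞ (fun z => ξ z k) (U ×ˢ Set.univ))
    (hη : ContDiffOn ℝ ∞ η (U ×ˢ Set.univ))
    (hζ : ζ = fun y => ξ (y, 0)) (ha : a = fun y => η (y, 1) - η (y, 0))
    (hb : b = fun y => η (y, 0)) (hx : x ∈ U) :
    (∀ u, ξ (x, u) = ζ x) ∧ (∀ u, η (x, u) = a x * u + b x) ∧
      (∀ i j, lieMetric G ζ i j x = 2 * confFactor G ζ x * G x i j) ∧
      (∀ i, 2 * pd i a x = (2 - n) * pd i (confFactor G ζ) x) ∧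
      laplacian G b x - V x * b x = 0 ∧
      (∑ k, ζ x k * pd k V x) + 2 * confFactor G ζ x * V x - laplacian G a x = 0 := by
  have hU := hG.isOpen
  have hn' : n ≠ 0 := by omega
  have hbase : ∀ y ∈ U, ∀ u, ξ (y, u) = ζ y := fun y hy u => by
    rw [hζ]; exact hS.eq_base hn hG hV hξ hη hy u
  have hlo := fun y (hy : y ∈ U) u => hS.lower_order hn' hG hV hξ hη hbase hy u
  have hab : ∀ y ∈ U, ∀ u, η (y, u) = a y * u + b y := fun y hy u => by
    rw [ha, hb]
    exact affine_of_pdu_pdu_eq_zero hU hη (fun t => (hlo y hy t).2.2) hy u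
  have hζs : ∀ k, ContDiffOn ℝ ∞ (fun y => ζ y k) U := fun k => by
    rw [hζ]; exact contDiffOn_slice (hξ k) 0
  have has : ContDiffOn ℝ ∞ a U := by
    rw [ha]; exact (contDiffOn_slice hη 1).sub (contDiffOn_slice hη 0)
  have hbs : ContDiffOn ℝ ∞ b U := by
    rw [hb]; exact contDiffOn_slice hη 0
  have hC : ∀ y ∈ U, ∀ i j, lieMetric G ζ i j y = 2 * confFactor G ζ y * G y i j := fun y hy =>
    (hS.conformal hn' hG hV hξ hη hbase hy 0 0).1
  have hψs := hG.contDiffOn_confFactor hζs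
  have hu : ∀ u, pdu η (x, u) = a x := fun u => pdu_of_affine hU hη hab hx u
  -- The part free of first and second derivatives is affine in `u`; its values at `0` and `1` give
  -- the equation for `b` and the condition on the potential.
  have hpoly : ∀ u : ℝ, (laplacian G a x - fderiv ℝ V x (ζ x) - 2 * confFactor G ζ x * V x) * u
      + (laplacian G b x - V x * b x) = 0 := by
    intro u
    have e := (hlo x hx u).1
    rw [hG.second_order_affine hη has hbs hab hx u, hab x hx u, hu u] at e
    linarith
  have hb0 : laplacian G b x - V x * b x = 0 := by simpa using hpoly 0
  refine ⟨hbase x hx, hab x hx, hC x hx, ?_, hb0, ?_⟩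
  -- In the linear coefficient the `drift` terms cancel against the multiplier; the remaining
  -- covector has its index raised by `g⁻¹`, which is injective.
  · intro i
    have key := hG.sum_inv_mul_eq_zero hx
      (w := fun i => 2 * pd i a x - (2 - n) * pd i (confFactor G ζ) x) (fun j => by
        have e := (hlo x hx 0).2.1 j
        rw [hG.first_order_affine hη has hbs hab hζs hψs hC hx 0 j, hu] at e
        linarith) i
    linarith
  · rw [← fderiv_eq_sum_pd]
    have e := hpoly 1
    rw [hb0] at e
    linarith

/-- Sufficiency of the determining equations in a coordinate domain. -/
theorem prolongApply_of_determining_equations (hG : IsMetricOn G U) (hV : ContDiffOn ℝ ∞ V U)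
    (hξ : ∀ k, ContDiffOn ℝ ∞ (fun z => ξ z k) (U ×ˢ Set.univ))
    (hη : ContDiffOn ℝ ∞ η (U ×ˢ Set.univ)) (ha : ContDiffOn ℝ ∞ a U) (hb : ContDiffOn ℝ ∞ b U)
    (hab : ∀ y ∈ U, ∀ u, η (y, u) = a y * u + b y)
    (hζ : ∀ k, ContDiffOn ℝ ∞ (fun y => ζ y k) U) (hψ : ContDiffOn ℝ ∞ ψ U)
    (hbase : ∀ y ∈ U, ∀ u, ξ (y, u) = ζ y)
    (hC : ∀ y ∈ U, ∀ i j, lieMetric G ζ i j y = 2 * ψ y * G y i j)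
    (h1 : ∀ y ∈ U, ∀ i, 2 * pd i a y = (2 - n) * pd i ψ y)
    (h2 : ∀ y ∈ U, laplacian G b y - V y * b y = 0)
    (h3 : ∀ y ∈ U, (∑ k, ζ y k * pd k V y) + 2 * ψ y * V y - laplacian G a y = 0)
    (J : Jet2 n) (hJ : J.1 ∈ U) (hq : ∀ i j, J.2.2.2 i j = J.2.2.2 j i) :
    prolongApply ξ η (kgFun G V) J = (a J.1 - 2 * ψ J.1) * kgFun G V J := by
  have hU := hG.isOpen
  obtain ⟨x, u, p, q⟩ := J
  simp only at hJ hq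
  have hu : pdu η (x, u) = a x := pdu_of_affine hU hη hab hJ u
  have huu : pdu (pdu η) (x, u) = 0 :=
    pdu_of_base hU (contDiffOn_pdu hU hη) (fun y hy t => pdu_of_affine hU hη hab hy t) hJ u
  -- Contraction with the symmetric `q` sees only the symmetric part of the symbol, and that part is
  -- known from the conformal equation.
  have hsym : ∑ i, ∑ j, symbolCoeff G ξ η x u p i j * q i j
      = (a x - 2 * ψ x) * ∑ i, ∑ j, (G x)⁻¹ i j * q i j := by
    have e1 : ∑ i, ∑ j, symbolCoeff G ξ η x u p i j * q i j
        = ∑ i, ∑ j, symbolCoeff G ξ η x u p j i * q i j := by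
      rw [Finset.sum_comm]
      exact Finset.sum_congr rfl fun i _ => Finset.sum_congr rfl fun j _ => by rw [hq]
    have e2 : 2 * ∑ i, ∑ j, symbolCoeff G ξ η x u p i j * q i j
        = ∑ i, ∑ j, 2 * (a x - 2 * ψ x) * ((G x)⁻¹ i j * q i j) := by
      rw [two_mul]
      conv_lhs => rw [e1]
      conv_lhs => arg 2; rw [← e1]
      rw [← Finset.sum_add_distrib]
      refine Finset.sum_congr rfl fun i _ => ?_
      rw [← Finset.sum_add_distrib]
      refine Finset.sum_congr rfl fun j _ => ?_
      rw [← add_mul, symbolCoeff_symmetrized hG hξ hbase hJ, hu,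
        (hG.lieInv_eq_iff hJ _).2 (hC x hJ), hG.inv_symm hJ j i]
      simp only [Matrix.neg_apply, Matrix.smul_apply, smul_eq_mul, hG.inv_symm hJ j i]
      ring
    simp only [← Finset.mul_sum] at e2
    linarith
  rw [prolongApply_affine hG hV hξ hη hJ u p hq, hsym,
    prolongApply_lower_order hG hV hξ hη hbase hJ u p, huu,
    hG.second_order_affine hη ha hb hab hJ u, hab x hJ u, kgFun_eq]
  simp only [hG.first_order_affine hη ha hb hab hζ hψ hC hJ u, h1 x hJ, sub_self, mul_zero,
    Finset.sum_const_zero, add_zero, mul_assoc (a x - 2 * ψ x), ← Finset.mul_sum]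
  have e2 := h2 x hJ
  have e3 := h3 x hJ
  rw [← fderiv_eq_sum_pd] at e3
  have e2' : laplacian G b x = V x * b x := by linarith
  have e3' : laplacian G a x = fderiv ℝ V x (ζ x) + 2 * ψ x * V x := by linarith
  rw [e2', e3']
  ring

end LocalTheorem

/-! ## Coordinate expressions on a manifold -/

section Charts

variable {n : ℕ} {M : Type*} [TopologicalSpace M] [ChartedSpace (Coord n) M]
  {φ : OpenPartialHomeomorph M (Coord n)}

theorem mdifferentiable_chart (hφ : φ ∈ IsManifold.maximalAtlas (𝓡 n) ∞ M) :
    φ.MDifferentiable (𝓡 n) (𝓡 n) :=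
  ⟨(contMDiffOn_of_mem_maximalAtlas hφ).mdifferentiableOn (by simp),
    (contMDiffOn_symm_of_mem_maximalAtlas hφ).mdifferentiableOn (by simp)⟩

theorem contDiffOn_comp_symm (hφ : φ ∈ IsManifold.maximalAtlas (𝓡 n) ∞ M) {f : M → ℝ}
    (hf : ContMDiff (𝓡 n) 𝓘(ℝ, ℝ) ∞ f) : ContDiffOn ℝ ∞ (fun x => f (φ.symm x)) φ.target := by
  rw [← contMDiffOn_iff_contDiffOn]
  exact hf.comp_contMDiffOn (contMDiffOn_symm_of_mem_maximalAtlas hφ)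

theorem contMDiffOn_cylinder (hφ : φ ∈ IsManifold.maximalAtlas (𝓡 n) ∞ M) :
    ContMDiffOn 𝓘(ℝ, Coord n × ℝ) ((𝓡 n).prod 𝓘(ℝ, ℝ)) ∞ (fun z : Jet0 n => (φ.symm z.1, z.2))
      (φ.target ×ˢ Set.univ) := by
  refine ContMDiffOn.prodMk ?_ ?_
  · exact (contMDiffOn_symm_of_mem_maximalAtlas hφ).comp
      (contMDiff_iff_contDiff.2 contDiff_fst).contMDiffOn fun z hz => hz.1
  · exact (contMDiff_iff_contDiff.2 contDiff_snd).contMDiffOn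

/-- The derivative of the inverse of a chart, as an endomorphism of the coordinate space. -/
def chartInv (φ : OpenPartialHomeomorph M (Coord n)) (x : Coord n) : Coord n →L[ℝ] Coord n :=
  mfderiv (𝓡 n) (𝓡 n) φ.symm x

/-- The derivative of a chart, as an endomorphism of the coordinate space. -/
def chartFwd (φ : OpenPartialHomeomorph M (Coord n)) (p : M) : Coord n →L[ℝ] Coord n :=
  mfderiv (𝓡 n) (𝓡 n) φ p

theorem chartFwd_chartInv (hφ : φ ∈ IsManifold.maximalAtlas (𝓡 n) ∞ M) {x : Coord n}
    (hx : x ∈ φ.target) (v : Coord n) : chartFwd φ (φ.symm x) (chartInv φ x v) = v :=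
  congrArg (fun L : Coord n →L[ℝ] Coord n => L v) ((mdifferentiable_chart hφ).comp_symm_deriv hx)

theorem chartInv_chartFwd (hφ : φ ∈ IsManifold.maximalAtlas (𝓡 n) ∞ M) {x : Coord n}
    (hx : x ∈ φ.target) (v : Coord n) : chartInv φ x (chartFwd φ (φ.symm x) v) = v := by
  have h := (mdifferentiable_chart hφ).symm_comp_deriv (φ.map_target hx)
  have h2 := congrArg (fun L : Coord n →L[ℝ] Coord n => L v) h
  rw [φ.right_inv hx] at h2
  exact h2

variable [IsManifold (𝓡 n) ∞ M]

/-- The metric as a function of a point and two vectors of the model space. -/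
def PseudoMetric.form (g : PseudoMetric n M) (p : M) : Coord n →L[ℝ] Coord n →L[ℝ] ℝ := g.val p

theorem PseudoMetric.inChart_eq (g : PseudoMetric n M) (x : Coord n) (i j : Fin n) :
    g.inChart φ x i j
      = g.form (φ.symm x) (chartInv φ x (coordVec i)) (chartInv φ x (coordVec j)) := rfl

/-- This is a constant field on the model space pushed forward by the tangent map of the smooth map
`φ.symm`. -/
theorem contMDiffOn_chartInv (hφ : φ ∈ IsManifold.maximalAtlas (𝓡 n) ∞ M) (v : Coord n) :
    ContMDiffOn (𝓡 n) (𝓡 n).tangent ∞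
      (fun x => (⟨φ.symm x, chartInv φ x v⟩ : TangentBundle (𝓡 n) M)) φ.target := by
  have h1 : ContMDiffOn (𝓡 n).tangent (𝓡 n).tangent ∞
      (tangentMapWithin (𝓡 n) (𝓡 n) φ.symm φ.target)
      (Bundle.TotalSpace.proj ⁻¹' φ.target) :=
    (contMDiffOn_symm_of_mem_maximalAtlas hφ).contMDiffOn_tangentMapWithin (by simp)
      φ.open_target.uniqueMDiffOn
  have h2 : ContMDiff (𝓡 n) (𝓡 n).tangent ∞
      (fun x : Coord n => (⟨x, v⟩ : TangentBundle (𝓡 n) (Coord n))) := by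
    intro x
    exact (contMDiffAt_vectorSpace_iff_contDiffAt (V := fun _ => v)).2 contDiffAt_const
  refine (h1.comp h2.contMDiffOn fun x hx => hx).congr fun x hx => ?_
  simp only [Function.comp, tangentMapWithin, mfderivWithin_of_isOpen φ.open_target hx]
  rfl

theorem PseudoMetric.contDiffOn_inChart (g : PseudoMetric n M)
    (hφ : φ ∈ IsManifold.maximalAtlas (𝓡 n) ∞ M) (i j : Fin n) :
    ContDiffOn ℝ ∞ (fun x => g.inChart φ x i j) φ.target := by
  rw [← contMDiffOn_iff_contDiffOn]
  intro x hx
  have hb := contMDiffOn_symm_of_mem_maximalAtlas hφ x hx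
  have : ContMDiffWithinAt (𝓡 n) ((𝓡 n).prod 𝓘(ℝ, ℝ)) ∞
      (fun m => Bundle.TotalSpace.mk' ℝ (E := Bundle.Trivial M ℝ) (φ.symm m)
        (g.val (φ.symm m) (chartInv φ m (coordVec i)) (chartInv φ m (coordVec j))))
      φ.target x := by
    apply ContMDiffWithinAt.clm_bundle_apply₂ (F₁ := Coord n) (F₂ := Coord n)
    · exact ContMDiffAt.comp_contMDiffWithinAt x g.contMDiff.contMDiffAt hb
    · exact contMDiffOn_chartInv hφ (coordVec i) x hx
    · exact contMDiffOn_chartInv hφ (coordVec j) x hx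
  simp only [Bundle.contMDiffWithinAt_totalSpace] at this
  exact this.2

theorem PseudoMetric.isMetricOn (g : PseudoMetric n M)
    (hφ : φ ∈ IsManifold.maximalAtlas (𝓡 n) ∞ M) : IsMetricOn (g.inChart φ) φ.target where
  isOpen := φ.open_target
  contDiffOn := g.contDiffOn_inChart hφ
  symm y _ := by
    ext i j
    exact g.symm _ _ _
  -- A kernel vector of the component matrix gives a tangent vector orthogonal to the coordinate
  -- frame. The frame spans, so nondegeneracy kills this vector, and injectivity of the chart
  -- derivative kills the kernel vector.
  det_ne_zero y hy h := by
    obtain ⟨v, hv0, hv⟩ := Matrix.exists_mulVec_eq_zero_iff.2 h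
    have h1 : ∀ j, g.form (φ.symm y) (chartInv φ y (coordVec j))
        (chartInv φ y (WithLp.toLp 2 v)) = 0 := by
      intro j
      have e := congrFun hv j
      simp only [Matrix.mulVec, dotProduct, g.inChart_eq, Pi.zero_apply] at e
      rw [eq_sum_coordVec (WithLp.toLp 2 v)]
      simp only [map_sum, map_smul, smul_eq_mul]
      rw [← e]
      exact Finset.sum_congr rfl fun k _ => mul_comm _ _
    have h2 : ∀ w, g.form (φ.symm y) (chartInv φ y (WithLp.toLp 2 v)) w = 0 := by
      intro w
      have e : g.form (φ.symm y) (chartInv φ y (WithLp.toLp 2 v)) w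
          = g.form (φ.symm y) w (chartInv φ y (WithLp.toLp 2 v)) := g.symm _ _ _
      rw [e, ← chartInv_chartFwd hφ hy w, eq_sum_coordVec (chartFwd φ (φ.symm y) w)]
      simp only [map_sum, map_smul, _root_.sum_apply, _root_.smul_apply, h1, smul_zero,
        Finset.sum_const_zero]
    have h3 : chartInv φ y (WithLp.toLp 2 v) = 0 := g.nondegenerate _ _ h2
    have h4 := chartFwd_chartInv hφ hy (WithLp.toLp 2 v)
    rw [h3, map_zero] at h4
    apply hv0
    funext k
    exact (congrArg (fun w : Coord n => w k) h4).symm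

theorem IsSmoothGenerator.contDiffOn_eta {ξ : ∀ p : M, ℝ → TangentSpace (𝓡 n) p} {η : M → ℝ → ℝ}
    (h : IsSmoothGenerator ξ η) (hφ : φ ∈ IsManifold.maximalAtlas (𝓡 n) ∞ M) :
    ContDiffOn ℝ ∞ (fun z : Jet0 n => η (φ.symm z.1) z.2) (φ.target ×ˢ Set.univ) := by
  rw [← contMDiffOn_iff_contDiffOn]
  exact h.2.comp_contMDiffOn (contMDiffOn_cylinder hφ)

theorem contMDiffOn_chartFwd (hφ : φ ∈ IsManifold.maximalAtlas (𝓡 n) ∞ M) :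
    ContMDiffOn (𝓡 n).tangent 𝓘(ℝ, Coord n) ∞
      (fun p : TangentBundle (𝓡 n) M => chartFwd φ p.1 p.2)
      (Bundle.TotalSpace.proj ⁻¹' φ.source) := by
  have h1 : ContMDiffOn (𝓡 n).tangent (𝓡 n).tangent ∞
      (tangentMapWithin (𝓡 n) (𝓡 n) φ φ.source) (Bundle.TotalSpace.proj ⁻¹' φ.source) :=
    (contMDiffOn_of_mem_maximalAtlas hφ).contMDiffOn_tangentMapWithin (by simp)
      φ.open_source.uniqueMDiffOn
  refine ((contMDiff_snd_tangentBundle_modelSpace (Coord n) (𝓡 n)).comp_contMDiffOn h1).congr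
    fun p hp => ?_
  simp only [Function.comp, tangentMapWithin, mfderivWithin_of_isOpen φ.open_source hp]
  rfl

theorem IsSmoothGenerator.contDiffOn_xi {ξ : ∀ p : M, ℝ → TangentSpace (𝓡 n) p} {η : M → ℝ → ℝ}
    (h : IsSmoothGenerator ξ η) (hφ : φ ∈ IsManifold.maximalAtlas (𝓡 n) ∞ M) (k : Fin n) :
    ContDiffOn ℝ ∞ (fun z : Jet0 n => familyInChart φ ξ z k) (φ.target ×ˢ Set.univ) := by
  have h1 : ContDiffOn ℝ ∞ (fun z : Jet0 n => familyInChart φ ξ z) (φ.target ×ˢ Set.univ) := by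
    rw [← contMDiffOn_iff_contDiffOn]
    exact (contMDiffOn_chartFwd hφ).comp (h.1.comp_contMDiffOn (contMDiffOn_cylinder hφ))
      fun z hz => φ.map_target hz.1
  exact (EuclideanSpace.proj (𝕜 := ℝ) k).contDiff.comp_contDiffOn h1

theorem contDiffOn_fieldInChart {ζ : ∀ p : M, TangentSpace (𝓡 n) p}
    (h : ContMDiff (𝓡 n) (𝓡 n).tangent ∞ (fun p => (⟨p, ζ p⟩ : TangentBundle (𝓡 n) M)))
    (hφ : φ ∈ IsManifold.maximalAtlas (𝓡 n) ∞ M) (k : Fin n) :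
    ContDiffOn ℝ ∞ (fun x => fieldInChart φ ζ x k) φ.target := by
  have h1 : ContDiffOn ℝ ∞ (fieldInChart φ ζ) φ.target := by
    rw [← contMDiffOn_iff_contDiffOn]
    exact (contMDiffOn_chartFwd hφ).comp
      (h.comp_contMDiffOn (contMDiffOn_symm_of_mem_maximalAtlas hφ)) fun x hx => φ.map_target hx
  exact (EuclideanSpace.proj (𝕜 := ℝ) k).contDiff.comp_contDiffOn h1

end Charts

/-! ## Change of coordinates -/

section Transition

variable {n : ℕ} {U : Set (Coord n)} {G G' : Coord n → Matrix (Fin n) (Fin n) ℝ}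
  {T : Coord n → Coord n} {ζ ζ' : Coord n → Coord n} {x : Coord n}

theorem fderiv_comp_apply {f : Coord n → ℝ} (hf : DifferentiableAt ℝ f (T x))
    (hT : DifferentiableAt ℝ T x) (v : Coord n) :
    fderiv ℝ (fun y => f (T y)) x v = fderiv ℝ f (T x) (fderiv ℝ T x v) := by
  have h := hf.hasFDerivAt.comp x hT.hasFDerivAt
  exact congrArg (fun L : Coord n →L[ℝ] ℝ => L v) h.fderiv

theorem fderiv_component (hT : DifferentiableAt ℝ T x) (v : Coord n) (k : Fin n) :
    fderiv ℝ (fun y => T y k) x v = fderiv ℝ T x v k := by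
  have h := (EuclideanSpace.proj (𝕜 := ℝ) k).hasFDerivAt.comp x
    hT.hasFDerivAt
  exact congrArg (fun L : Coord n →L[ℝ] ℝ => L v) h.fderiv

/-- The Lie derivative of a metric is a tensor. -/
theorem lieMetric_transition (hU : IsOpen U) (hT : ContDiffOn ℝ ∞ T U)
    (hG' : ∀ y ∈ U, ∀ k l, DifferentiableAt ℝ (fun y => G' y k l) (T y))
    (hζ' : ∀ k, DifferentiableAt ℝ (fun y => ζ' y k) (T x))
    (hζ : ∀ k, ContDiffOn ℝ ∞ (fun y => ζ y k) U)
    (hG : ∀ y ∈ U, G y = (jac T y).transpose * G' (T y) * jac T y)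
    (hTζ : ∀ y ∈ U, ζ' (T y) = fderiv ℝ T y (ζ y)) (hx : x ∈ U) :
    Matrix.of (fun i j => lieMetric G ζ i j x)
      = (jac T x).transpose * Matrix.of (fun k l => lieMetric G' ζ' k l (T x)) * jac T x := by
  have hTk : ∀ k, ContDiffOn ℝ ∞ (fun y => T y k) U := fun k =>
    (EuclideanSpace.proj (𝕜 := ℝ) k).contDiff.comp_contDiffOn hT
  have hTd : ∀ y ∈ U, DifferentiableAt ℝ T y := fun y hy =>
    (hT.contDiffAt (hU.mem_nhds hy)).differentiableAt (by simp)
  have hA : ∀ i j, DifferentiableAt ℝ (fun y => jac T y i j) x := fun i j =>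
    differentiableAt_of_contDiffOn hU (contDiffOn_pd hU (hTk i) j) hx
  have hGT : ∀ i j, DifferentiableAt ℝ (fun y => G' (T y) i j) x := fun i j =>
    (hG' x hx i j).comp x (hTd x hx)
  have hAT : ∀ i j, DifferentiableAt ℝ (fun y => (jac T y).transpose i j) x := fun i j => hA j i
  have hAG : ∀ i j, DifferentiableAt ℝ (fun y => ((jac T y).transpose * G' (T y)) i j) x :=
    fun i j => by
      simp only [Matrix.mul_apply]
      exact DifferentiableAt.fun_sum fun k _ => (hAT i k).fun_mul (hGT k j)
  have e1 : matDeriv G x (ζ x)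
      = matDeriv (fun y => (jac T y).transpose * G' (T y) * jac T y) x (ζ x) := by
    ext i j
    exact congrArg (fun L : Coord n →L[ℝ] ℝ => L (ζ x))
      (fderiv_congr_on hU (fun y hy => by rw [hG y hy]) hx)
  have e2 : matDeriv (fun y => G' (T y)) x (ζ x) = matDeriv G' (T x) (ζ' (T x)) := by
    ext i j
    simp only [matDeriv, Matrix.of_apply]
    rw [fderiv_comp_apply (hG' x hx i j) (hTd x hx), hTζ x hx]
  -- Differentiating `ζ' ∘ T = dT ζ` trades the second derivatives of `T` for Jacobians of the two
  -- fields. The terms with `jac ζ` then cancel in the Lie derivative, which is why the result is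
  -- tensorial.
  have e3 : matDeriv (jac T) x (ζ x) = jac ζ' (T x) * jac T x - jac T x * jac ζ x := by
    ext k j
    have h1 := pd_fderiv_apply hU (hTk k) hζ hx j
    have h2 : pd j (fun y => fderiv ℝ (fun z => T z k) y (ζ y)) x
        = pd j (fun y => ζ' (T y) k) x :=
      pd_congr hU (fun y hy => by rw [fderiv_component (hTd y hy), hTζ y hy]) hx j
    have h3 : pd j (fun y => ζ' (T y) k) x = ∑ l, jac ζ' (T x) k l * jac T x l j := by
      rw [pd, fderiv_comp_apply (f := fun y => ζ' y k) (hζ' k) (hTd x hx), fderiv_eq_sum_pd]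
      refine Finset.sum_congr rfl fun l _ => ?_
      rw [← fderiv_component (hTd x hx), mul_comm]
      rfl
    rw [h2, h3] at h1
    simp only [matDeriv, Matrix.of_apply, Matrix.sub_apply, Matrix.mul_apply]
    rw [h1]
    have h4 : ∑ l, jac T x k l * jac ζ x l j
        = ∑ l, pd j (fun y => ζ y l) x * pd l (fun y => T y k) x :=
      Finset.sum_congr rfl fun l _ => mul_comm _ _
    rw [h4, add_sub_cancel_right]
    rfl
  have e4 : matDeriv (fun y => (jac T y).transpose) x (ζ x)
      = (matDeriv (jac T) x (ζ x)).transpose := rfl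
  rw [of_lieMetric, of_lieMetric, e1, matDeriv_mul hAG hA, matDeriv_mul hAT hGT, e2, e4, e3,
    hG x hx]
  simp only [Matrix.transpose_sub, Matrix.transpose_mul, Matrix.mul_add, Matrix.add_mul,
    Matrix.mul_sub, Matrix.sub_mul, Matrix.mul_assoc]
  abel

end Transition

/-! ### Metric, vector fields and conformal factor under a change of chart -/

section ChangeOfChart

variable {n : ℕ} {M : Type*} [TopologicalSpace M] [ChartedSpace (Coord n) M]
  [IsManifold (𝓡 n) ∞ M] {φ φ' : OpenPartialHomeomorph M (Coord n)} {x : Coord n}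

/-- Chain rule for `φ' ∘ φ.symm`, followed by inversion of the derivative of `φ'`. -/
theorem chartInv_transition (hφ : φ ∈ IsManifold.maximalAtlas (𝓡 n) ∞ M)
    (hφ' : φ' ∈ IsManifold.maximalAtlas (𝓡 n) ∞ M) (hx : x ∈ (φ.symm.trans φ').source)
    (v : Coord n) :
    chartInv φ x v = chartInv φ' (φ' (φ.symm x)) (fderiv ℝ (fun y => φ' (φ.symm y)) x v) := by
  have hx' : x ∈ φ.target ∧ φ.symm x ∈ φ'.source := by simpa using hx
  have h1 : fderiv ℝ (fun y => φ' (φ.symm y)) x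
      = (chartFwd φ' (φ.symm x)).comp (chartInv φ x) := by
    rw [← mfderiv_eq_fderiv]
    exact mfderiv_comp (I' := 𝓡 n) x ((mdifferentiable_chart hφ').mdifferentiableAt hx'.2)
      ((mdifferentiable_chart hφ).mdifferentiableAt_symm hx'.1)
  have h2 := chartInv_chartFwd hφ' (φ'.map_source hx'.2) (chartInv φ x v)
  rw [φ'.left_inv hx'.2] at h2
  rw [h1]
  exact h2.symm

theorem fieldInChart_transition (hφ : φ ∈ IsManifold.maximalAtlas (𝓡 n) ∞ M)
    (hφ' : φ' ∈ IsManifold.maximalAtlas (𝓡 n) ∞ M) (ζ : ∀ p : M, TangentSpace (𝓡 n) p)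
    (hx : x ∈ (φ.symm.trans φ').source) :
    fieldInChart φ' ζ (φ' (φ.symm x))
      = fderiv ℝ (fun y => φ' (φ.symm y)) x (fieldInChart φ ζ x) := by
  have hx' : x ∈ φ.target ∧ φ.symm x ∈ φ'.source := by simpa using hx
  -- All tangent spaces are the model space, so the field can be treated as nondependent and equal
  -- base points substituted.
  let Z : M → Coord n := ζ
  have h1 : fieldInChart φ ζ x = chartFwd φ (φ.symm x) (Z (φ.symm x)) := rfl
  have h2 : fieldInChart φ' ζ (φ' (φ.symm x))
      = chartFwd φ' (φ'.symm (φ' (φ.symm x))) (Z (φ'.symm (φ' (φ.symm x)))) := rfl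
  have h3 := chartInv_transition hφ hφ' hx (fieldInChart φ ζ x)
  rw [h1, chartInv_chartFwd hφ hx'.1, ← h1] at h3
  have h4 := congrArg (chartFwd φ' (φ'.symm (φ' (φ.symm x)))) h3
  rw [chartFwd_chartInv hφ' (φ'.map_source hx'.2)] at h4
  rw [h2, ← h4, φ'.left_inv hx'.2]

theorem PseudoMetric.inChart_transition (g : PseudoMetric n M)
    (hφ : φ ∈ IsManifold.maximalAtlas (𝓡 n) ∞ M)
    (hφ' : φ' ∈ IsManifold.maximalAtlas (𝓡 n) ∞ M) (hx : x ∈ (φ.symm.trans φ').source)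
    (hT : DifferentiableAt ℝ (fun y => φ' (φ.symm y)) x) :
    g.inChart φ x = (jac (fun y => φ' (φ.symm y)) x).transpose
      * g.inChart φ' (φ' (φ.symm x)) * jac (fun y => φ' (φ.symm y)) x := by
  have hx' : x ∈ φ.target ∧ φ.symm x ∈ φ'.source := by simpa using hx
  have h1 : ∀ i, chartInv φ x (coordVec i) = ∑ k, jac (fun y => φ' (φ.symm y)) x k i •
      chartInv φ' (φ' (φ.symm x)) (coordVec k) := by
    intro i
    rw [chartInv_transition hφ hφ' hx]
    conv_lhs => rw [eq_sum_coordVec (fderiv ℝ (fun y => φ' (φ.symm y)) x (coordVec i))]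
    rw [map_sum]
    refine Finset.sum_congr rfl fun k _ => ?_
    rw [map_smul, ← fderiv_component hT]
    rfl
  ext i j
  simp only [g.inChart_eq, Matrix.mul_apply, Matrix.transpose_apply, h1, map_sum, map_smul,
    _root_.sum_apply, _root_.smul_apply, smul_eq_mul, φ'.left_inv hx'.2, Finset.sum_mul,
    Finset.mul_sum]
  exact Finset.sum_congr rfl fun k _ => Finset.sum_congr rfl fun l _ => by ring

/-- The conformal factor read in a chart does not depend on the chart. -/
theorem confFactor_transition (hn : n ≠ 0) (g : PseudoMetric n M)
    {ζ : ∀ p : M, TangentSpace (𝓡 n) p}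
    (hζ : ContMDiff (𝓡 n) (𝓡 n).tangent ∞ (fun p => (⟨p, ζ p⟩ : TangentBundle (𝓡 n) M)))
    (hφ : φ ∈ IsManifold.maximalAtlas (𝓡 n) ∞ M)
    (hφ' : φ' ∈ IsManifold.maximalAtlas (𝓡 n) ∞ M) (hx : x ∈ (φ.symm.trans φ').source)
    {c : ℝ} (hC : ∀ i j, lieMetric (g.inChart φ') (fieldInChart φ' ζ) i j (φ' (φ.symm x))
      = 2 * c * g.inChart φ' (φ' (φ.symm x)) i j) :
    confFactor (g.inChart φ) (fieldInChart φ ζ) x = c := by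
  have hmem : ∀ y ∈ (φ.symm.trans φ').source, y ∈ φ.target ∧ φ.symm y ∈ φ'.source :=
    fun y hy => by simpa using hy
  have hU := (φ.symm.trans φ').open_source
  have hT : ContDiffOn ℝ ∞ (fun y => φ' (φ.symm y)) (φ.symm.trans φ').source := by
    rw [← contMDiffOn_iff_contDiffOn]
    exact (contMDiffOn_of_mem_maximalAtlas hφ').comp
      ((contMDiffOn_symm_of_mem_maximalAtlas hφ).mono fun y hy => (hmem y hy).1)
      fun y hy => (hmem y hy).2
  have hTd : ∀ y ∈ (φ.symm.trans φ').source, DifferentiableAt ℝ (fun y => φ' (φ.symm y)) y :=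
    fun y hy => (hT.contDiffAt (hU.mem_nhds hy)).differentiableAt (by simp)
  have hG := fun y hy => g.inChart_transition hφ hφ' hy (hTd y hy)
  have key := lieMetric_transition (G := g.inChart φ) (G' := g.inChart φ')
    (T := fun y => φ' (φ.symm y)) (ζ := fieldInChart φ ζ) (ζ' := fieldInChart φ' ζ) hU hT
    (fun y hy k l => differentiableAt_of_contDiffOn φ'.open_target (g.contDiffOn_inChart hφ' k l)
      (φ'.map_source (hmem y hy).2))
    (fun k => differentiableAt_of_contDiffOn φ'.open_target (contDiffOn_fieldInChart hζ hφ' k)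
      (φ'.map_source (hmem x hx).2))
    (fun k => (contDiffOn_fieldInChart hζ hφ k).mono fun y hy => (hmem y hy).1)
    hG (fun y hy => fieldInChart_transition hφ hφ' ζ hy) hx
  have h1 : Matrix.of (fun k l => lieMetric (g.inChart φ') (fieldInChart φ' ζ) k l
      (φ' (φ.symm x))) = (2 * c) • g.inChart φ' (φ' (φ.symm x)) := by
    ext k l
    exact hC k l
  refine (g.isMetricOn hφ).confFactor_eq (hmem x hx).1 hn fun i j => ?_
  rw [h1, Matrix.mul_smul, Matrix.smul_mul, ← hG x hx] at key
  exact congrFun (congrFun key i) j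

end ChangeOfChart

/-! ## Symmetries on a manifold -/

section Global

variable {n : ℕ} {M : Type*} [TopologicalSpace M] [ChartedSpace (Coord n) M]
  [IsManifold (𝓡 n) ∞ M]

/-- The conformal factor of a conformal vector field, read in the preferred charts. -/
def globalFactor (g : PseudoMetric n M) (ζ : ∀ p : M, TangentSpace (𝓡 n) p) (p : M) : ℝ :=
  confFactor (g.inChart (chartAt (Coord n) p)) (fieldInChart (chartAt (Coord n) p) ζ)
    (chartAt (Coord n) p p)

variable {g : PseudoMetric n M} {ζ : ∀ p : M, TangentSpace (𝓡 n) p}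

/-- The factor at a point is defined in that point's own preferred chart; chart independence
transfers it to any other chart, and so makes it smooth in `isCKV_globalFactor`. -/
theorem globalFactor_eq (hn : n ≠ 0)
    (hζ : ContMDiff (𝓡 n) (𝓡 n).tangent ∞ (fun p => (⟨p, ζ p⟩ : TangentBundle (𝓡 n) M)))
    (hC : ∀ φ ∈ IsManifold.maximalAtlas (𝓡 n) ∞ M, ∀ x ∈ φ.target, ∀ i j,
      lieMetric (g.inChart φ) (fieldInChart φ ζ) i j x
        = 2 * confFactor (g.inChart φ) (fieldInChart φ ζ) x * g.inChart φ x i j)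
    {φ : OpenPartialHomeomorph M (Coord n)} (hφ : φ ∈ IsManifold.maximalAtlas (𝓡 n) ∞ M)
    {x : Coord n} (hx : x ∈ φ.target) :
    globalFactor g ζ (φ.symm x) = confFactor (g.inChart φ) (fieldInChart φ ζ) x := by
  have hφ' := IsManifold.chart_mem_maximalAtlas (I := 𝓡 n) (n := ∞) (φ.symm x)
  have hs := mem_chart_source (Coord n) (φ.symm x)
  refine (confFactor_transition hn g hζ hφ hφ' ⟨hx, hs⟩ ?_).symm
  exact hC _ hφ' _ ((chartAt (Coord n) (φ.symm x)).map_source hs)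

theorem isCKV_globalFactor (hn : n ≠ 0)
    (hζ : ContMDiff (𝓡 n) (𝓡 n).tangent ∞ (fun p => (⟨p, ζ p⟩ : TangentBundle (𝓡 n) M)))
    (hC : ∀ φ ∈ IsManifold.maximalAtlas (𝓡 n) ∞ M, ∀ x ∈ φ.target, ∀ i j,
      lieMetric (g.inChart φ) (fieldInChart φ ζ) i j x
        = 2 * confFactor (g.inChart φ) (fieldInChart φ ζ) x * g.inChart φ x i j) :
    IsCKV g ζ (globalFactor g ζ) := by
  refine ⟨hζ, fun p => ?_, fun φ hφ x hx i j => ?_⟩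
  · have hφ := IsManifold.chart_mem_maximalAtlas (I := 𝓡 n) (n := ∞) p
    set φ := chartAt (Coord n) p
    have hp : p ∈ φ.source := mem_chart_source (Coord n) p
    have h1 : ContMDiffAt (𝓡 n) 𝓘(ℝ, ℝ) ∞
        (confFactor (g.inChart φ) (fieldInChart φ ζ)) (φ p) :=
      contMDiffAt_iff_contDiffAt.2 (((g.isMetricOn hφ).contDiffOn_confFactor
        (contDiffOn_fieldInChart hζ hφ)).contDiffAt (φ.open_target.mem_nhds (φ.map_source hp)))
    refine (h1.comp p (contMDiffAt_of_mem_maximalAtlas hφ hp)).congr_of_eventuallyEq ?_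
    filter_upwards [φ.open_source.mem_nhds hp] with q hq
    have := globalFactor_eq hn hζ hC hφ (φ.map_source hq)
    rw [φ.left_inv hq] at this
    exact this
  · rw [globalFactor_eq hn hζ hC hφ hx]
    exact hC φ hφ x hx i j

/-- A smooth function on a connected manifold whose partial derivatives vanish in all charts is
constant. -/
theorem eq_of_pd_eq_zero [PreconnectedSpace M] {f : M → ℝ} (hf : ContMDiff (𝓡 n) 𝓘(ℝ, ℝ) ∞ f)
    (h : ∀ φ ∈ IsManifold.maximalAtlas (𝓡 n) ∞ M, ∀ x ∈ φ.target, ∀ i,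
      pd i (fun y => f (φ.symm y)) x = 0) (p q : M) : f p = f q := by
  have hloc : IsLocallyConstant f := by
    rw [IsLocallyConstant.iff_eventually_eq]
    intro p
    have hφ := IsManifold.chart_mem_maximalAtlas (I := 𝓡 n) (n := ∞) p
    set φ := chartAt (Coord n) p
    have hp : p ∈ φ.source := mem_chart_source (Coord n) p
    obtain ⟨ε, hε, hball⟩ := Metric.isOpen_iff.1 φ.open_target (φ p) (φ.map_source hp)
    have hd := contDiffOn_comp_symm hφ hf
    have hcont := (φ.continuousAt hp).preimage_mem_nhds (Metric.ball_mem_nhds (φ p) hε)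
    filter_upwards [φ.open_source.mem_nhds hp, hcont] with q hq hq'
    have key : f (φ.symm (φ q)) = f (φ.symm (φ p)) :=
      Metric.isOpen_ball.is_const_of_fderiv_eq_zero (𝕜 := ℝ) (f := fun y => f (φ.symm y))
        (convex_ball (φ p) ε).isPreconnected
        (fun y hy => (differentiableAt_of_contDiffOn φ.open_target hd
          (hball hy)).differentiableWithinAt)
        (fun y hy => by
          ext v
          rw [fderiv_eq_sum_pd]
          simp [h φ hφ y (hball hy)]) hq' (Metric.mem_ball_self hε)
    rwa [φ.left_inv hq, φ.left_inv hp] at key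
  exact hloc.apply_eq_of_preconnectedSpace p q

/-- No differentiability of `f` is required: scaling by a real constant commutes with `fderiv`
unconditionally, also for `c = 0`. -/
theorem laplacian_affine (G : Coord n → Matrix (Fin n) (Fin n) ℝ) (c d : ℝ) (f : Coord n → ℝ)
    (x : Coord n) : laplacian G (fun y => c * f y + d) x = c * laplacian G f x := by
  have h1 : ∀ (c : ℝ) (f : Coord n → ℝ) (x : Coord n) i,
      pd i (fun y => c * f y) x = c * pd i f x := by
    intro c f x i
    have : fderiv ℝ (fun y => c * f y) x = c • fderiv ℝ f x :=
      congrFun (fderiv_const_smul_field c) x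
    rw [pd, this]
    rfl
  have h2 : ∀ j y, pd j (fun y => c * f y + d) y = c * pd j f y := by
    intro j y
    rw [← h1, pd, fderiv_add_const]
    rfl
  unfold laplacian
  simp only [h2]
  have h3 : ∀ i, (fun y => sqrtDet G y * ∑ j, (G y)⁻¹ i j * (c * pd j f y))
      = fun y => c * (sqrtDet G y * ∑ j, (G y)⁻¹ i j * pd j f y) := by
    intro i
    funext y
    simp only [Finset.mul_sum]
    exact Finset.sum_congr rfl fun j _ => by ring
  simp only [h3, h1, ← Finset.mul_sum]
  ring

variable {V : M → ℝ} {ξ : ∀ p : M, ℝ → TangentSpace (𝓡 n) p} {η : M → ℝ → ℝ}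

/-- The generators of the Lie point symmetries of the Klein–Gordon equation are determined by
conformal Killing vectors. -/
theorem isLiePointSymmetry_iff [ConnectedSpace M] (hn : 2 ≤ n) (g : PseudoMetric n M)
    (hV : ContMDiff (𝓡 n) 𝓘(ℝ, ℝ) ∞ V) :
    IsLiePointSymmetry g V ξ η ↔
      ∃ (ζ : ∀ p : M, TangentSpace (𝓡 n) p) (ψ : M → ℝ) (a₀ : ℝ) (b : M → ℝ),
        IsCKV g ζ ψ ∧ IsKGSolution g V b ∧
        PotentialCondition g V ζ ψ ((2 - (n : ℝ)) / 2) ∧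
        (∀ p u, ξ p u = ζ p) ∧
        (∀ p u, η p u = (2 - (n : ℝ)) / 2 * ψ p * u + a₀ * u + b p) := by
  have hn' : n ≠ 0 := by omega
  constructor
  · rintro ⟨hX, hsym⟩
    -- Necessity uses only that `X^[2] H` vanishes where `H` does, so nothing about `λ` beyond its
    -- existence enters.
    have hS : ∀ φ ∈ IsManifold.maximalAtlas (𝓡 n) ∞ M, VanishesOnShell (g.inChart φ)
        (fun x => V (φ.symm x)) φ.target (familyInChart φ ξ)
        (fun z => η (φ.symm z.1) z.2) := by
      intro φ hφ J hJ hq h0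
      obtain ⟨lam, hlam⟩ := hsym φ hφ
      rw [hlam J hJ hq, h0, mul_zero]
    let ζ : ∀ p : M, TangentSpace (𝓡 n) p := fun p => ξ p 0
    let a : M → ℝ := fun p => η p 1 - η p 0
    let b : M → ℝ := fun p => η p 0
    have hslice : ∀ u : ℝ, ContMDiff (𝓡 n) ((𝓡 n).prod 𝓘(ℝ, ℝ)) ∞ (fun p : M => (p, u)) :=
      fun u => contMDiff_id.prodMk contMDiff_const
    have hζs : ContMDiff (𝓡 n) (𝓡 n).tangent ∞ (fun p => (⟨p, ζ p⟩ : TangentBundle (𝓡 n) M)) :=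
      hX.1.comp (hslice 0)
    have hηu : ∀ u : ℝ, ContMDiff (𝓡 n) 𝓘(ℝ, ℝ) ∞ (fun p => η p u) := fun u =>
      hX.2.comp (hslice u)
    have has : ContMDiff (𝓡 n) 𝓘(ℝ, ℝ) ∞ a := (hηu 1).sub (hηu 0)
    have key : ∀ φ (hφ : φ ∈ IsManifold.maximalAtlas (𝓡 n) ∞ M) x (hx : x ∈ φ.target), _ :=
      fun φ hφ x hx => (hS φ hφ).determining_equations (x := x) (ζ := fieldInChart φ ζ)
        (a := fun y => a (φ.symm y)) (b := fun y => b (φ.symm y)) hn (g.isMetricOn hφ)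
        (contDiffOn_comp_symm hφ hV) (hX.contDiffOn_xi hφ) (hX.contDiffOn_eta hφ) rfl rfl rfl hx
    have hC : ∀ φ ∈ IsManifold.maximalAtlas (𝓡 n) ∞ M, ∀ x ∈ φ.target, ∀ i j,
        lieMetric (g.inChart φ) (fieldInChart φ ζ) i j x
          = 2 * confFactor (g.inChart φ) (fieldInChart φ ζ) x * g.inChart φ x i j :=
      fun φ hφ x hx => (key φ hφ x hx).2.2.1
    have hfac := fun φ hφ x hx => globalFactor_eq (x := x) (φ := φ) hn' hζs hC hφ hx
    have hckv := isCKV_globalFactor hn' hζs hC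
    set ψ := globalFactor g ζ with hψ
    obtain ⟨p₀⟩ : Nonempty M := inferInstance
    -- By the gradient equation `a - (2 - n)/2 ψ` has zero derivative in every chart; connectedness
    -- makes it a constant, which becomes `a₀`.
    have hconst : ∀ p, a p = (2 - (n : ℝ)) / 2 * ψ p
        + (a p₀ - (2 - (n : ℝ)) / 2 * ψ p₀) := by
      intro p
      have e := eq_of_pd_eq_zero (f := fun p => a p - (2 - (n : ℝ)) / 2 * ψ p)
        (has.sub (contMDiff_const.mul hckv.2.1)) (fun φ hφ x hx i => by
          have hψd := differentiableAt_of_contDiffOn φ.open_target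
            (contDiffOn_comp_symm hφ hckv.2.1) hx
          rw [pd_sub (differentiableAt_of_contDiffOn φ.open_target
            (contDiffOn_comp_symm hφ has) hx) (hψd.const_mul _), pd_const_mul hψd,
            pd_congr φ.open_target (fun y hy => hfac φ hφ y hy) hx]
          have := (key φ hφ x hx).2.2.2.1 i
          linarith) p p₀
      linarith
    refine ⟨ζ, ψ, a p₀ - (2 - (n : ℝ)) / 2 * ψ p₀, b, hckv, ⟨hηu 0, ?_⟩, ?_, ?_, ?_⟩
    · exact fun φ hφ x hx => (key φ hφ x hx).2.2.2.2.1
    · intro φ hφ x hx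
      have e := (key φ hφ x hx).2.2.2.2.2
      simp only [hconst (φ.symm _)] at e
      rw [laplacian_affine, ← hfac φ hφ x hx] at e
      exact e
    · intro p u
      have hφ := IsManifold.chart_mem_maximalAtlas (I := 𝓡 n) (n := ∞) p
      have hp := mem_chart_source (Coord n) p
      have hx := (chartAt (Coord n) p).map_source hp
      have e := (key _ hφ _ hx).1 u
      -- Equality of components in a chart is turned into equality of tangent vectors by applying
      -- the inverse of the chart derivative.
      have e' := congrArg (chartInv (chartAt (Coord n) p) (chartAt (Coord n) p p)) e
      let Z : M → ℝ → Coord n := ξ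
      have e1 := chartInv_chartFwd hφ hx (Z ((chartAt (Coord n) p).symm (chartAt (Coord n) p p)) u)
      have e2 := chartInv_chartFwd hφ hx (Z ((chartAt (Coord n) p).symm (chartAt (Coord n) p p)) 0)
      have e3 : Z ((chartAt (Coord n) p).symm (chartAt (Coord n) p p)) u
          = Z ((chartAt (Coord n) p).symm (chartAt (Coord n) p p)) 0 := e1.symm.trans (e'.trans e2)
      rw [(chartAt (Coord n) p).left_inv hp] at e3
      exact e3
    · intro p u
      have hφ := IsManifold.chart_mem_maximalAtlas (I := 𝓡 n) (n := ∞) p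
      have hp := mem_chart_source (Coord n) p
      have e := (key _ hφ _ ((chartAt (Coord n) p).map_source hp)).2.1 u
      simp only [(chartAt (Coord n) p).left_inv hp] at e
      rw [e, hconst p]
      ring
  · rintro ⟨ζ, ψ, a₀, b, hckv, hb, hpot, hξ, hη⟩
    have hX : IsSmoothGenerator ξ η := by
      refine ⟨?_, ?_⟩
      · simp only [hξ]
        exact hckv.1.comp contMDiff_fst
      · simp only [hη]
        exact (((contMDiff_const.mul (hckv.2.1.comp contMDiff_fst)).mul contMDiff_snd).add
          (contMDiff_const.mul contMDiff_snd)).add (hb.1.comp contMDiff_fst)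
    -- The multiplier is `a - 2 ψ` with `a = (2 - n)/2 ψ + a₀`; it depends on the base point of the
    -- jet only.
    refine ⟨hX, fun φ hφ => ⟨fun J => (2 - (n : ℝ)) / 2 * ψ (φ.symm J.1) + a₀
      - 2 * ψ (φ.symm J.1), fun J hJ hq => ?_⟩⟩
    have hψs := contDiffOn_comp_symm hφ hckv.2.1
    refine prolongApply_of_determining_equations (ζ := fieldInChart φ ζ)
      (a := fun y => (2 - (n : ℝ)) / 2 * ψ (φ.symm y) + a₀) (b := fun y => b (φ.symm y))
      (ψ := fun y => ψ (φ.symm y)) (g.isMetricOn hφ) (contDiffOn_comp_symm hφ hV)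
      (hX.contDiffOn_xi hφ) (hX.contDiffOn_eta hφ) ((contDiffOn_const.mul hψs).add contDiffOn_const)
      (contDiffOn_comp_symm hφ hb.1) (fun y _ u => ?_) (contDiffOn_fieldInChart hckv.1 hφ) hψs
      (fun y _ u => ?_) (hckv.2.2 φ hφ) (fun y hy i => ?_) (hb.2 φ hφ) (fun y hy => ?_) J hJ hq
    · simp only [hη]
      ring
    · simp only [familyInChart, fieldInChart, hξ]
    · have hd := differentiableAt_of_contDiffOn φ.open_target hψs hy
      rw [pd_add (hd.const_mul _) (differentiableAt_const a₀), pd_const_mul hd]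
      simp only [pd, fderiv_fun_const, Pi.zero_apply, _root_.zero_apply]
      ring
    · rw [laplacian_affine]
      exact hpot φ hφ y hy

end Global

end LieSymmetry

end

theorem theorem3 {n : ℕ} {M : Type*} [TopologicalSpace M] [ChartedSpace (Coord n) M]
    [IsManifold (𝓡 n) ∞ M] [ConnectedSpace M] (g : PseudoMetric n M)
    (V : M → ℝ) (hV : ContMDiff (𝓡 n) 𝓘(ℝ, ℝ) ∞ V)
    (ξ : ∀ p : M, ℝ → TangentSpace (𝓡 n) p) (η : M → ℝ → ℝ) :
    (2 < n →
      (IsLiePointSymmetry g V ξ η ↔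
        ∃ (ζ : ∀ p : M, TangentSpace (𝓡 n) p) (ψ : M → ℝ) (a₀ : ℝ) (b : M → ℝ),
          IsCKV g ζ ψ ∧ IsKGSolution g V b ∧
          PotentialCondition g V ζ ψ ((2 - (n : ℝ)) / 2) ∧
          (∀ p u, ξ p u = ζ p) ∧
          (∀ p u, η p u = (2 - (n : ℝ)) / 2 * ψ p * u + a₀ * u + b p))) ∧
    (n = 2 →
      (IsLiePointSymmetry g V ξ η ↔
        ∃ (ζ : ∀ p : M, TangentSpace (𝓡 n) p) (ψ : M → ℝ) (a₀ : ℝ) (b : M → ℝ),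
          IsCKV g ζ ψ ∧ IsKGSolution g V b ∧
          PotentialCondition g V ζ ψ 0 ∧
          (∀ p u, ξ p u = ζ p) ∧
          (∀ p u, η p u = a₀ * u + b p))) := by

  refine ⟨fun hn => isLiePointSymmetry_iff hn.le g hV, fun hn => ?_⟩
  -- In dimension two the common coefficient of `ψ u` in `η` and of `Δψ` in the potential condition
  -- is zero.
  have hc : (2 - (n : ℝ)) / 2 = 0 := by
    rw [hn]
    norm_num
  have h := isLiePointSymmetry_iff (ξ := ξ) (η := η) hn.ge g hV
  simpa only [hc, zero_mul, zero_add] using h
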